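/- Setting. On a probability space $(\Omega,\mathscr A,\mathbb P)$ let $(\xi_t,X_\tau)$ be a conjugate process: $\xi_0,\xi_1,\dots$ are random Borel probability measures on $\mathbb R$, $(X_\tau:\tau\ge 0)$ is a real process, and, with $\Xi=\sigma(\xi_0,\xi_1,\dots)$, $\mathbb P[X_\tau\in B\mid\Xi]=\xi_t(B)$ a.s. for every Borel set $B$ and every $\tau\in[t,t+1)$, $t=0,1,\dots$. Assume that $(\xi_t)$ is stationary and that the process is cyclic-independent: given $\Xi$, the processes $(X_\tau:\tau\in[t,t+1))$, $t=0,1,\dots$, are independent. Let $\mathbb E\xi_0$ be the barycenter of $\xi_0$, and let $\mu$ be a finite Borel measure on $\mathbb R$ which is equivalent to Lebesgue measure on some interval containing the support of $\mathbb E\xi_0$; $\langle\cdot,\cdot\rangle$ and $\|\cdot\|$ are those of $L^2(\mu)$. Put $F_t(x)=\xi_t(-\infty,x]$, $\mathbb EF_0(x)=\mathbb E\xi_0(-\infty,x]$ and $C_k(x,y)=\operatorname{Cov}(F_0(x),F_k(y))$. Fix an integer $p\ge1$ and let $R^\mu$ be the integral operator on $L^2(\mu)$ with kernel $\sum_{k=1}^p\int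 C_k(x,z)C_k(y,z)\,\mu(dz)$. Assume that $R^\mu$ and the integral operator $C_0^\mu$ with kernel $C_0$ have ranges with the same closure. Let $\theta_1\ge\theta_2\ge\cdots\geq 0$ be the eigenvalues of $R^\mu$ (repeated by multiplicity; the sequence contains zeros if and only if $R^\mu$ has finite rank) with orthonormal eigenfunctions $(\psi_j)_{j\in\mathbb N}$, and put $W_{tj}=\langle F_t-\mathbb EF_0,\psi_j\rangle$. Estimators. In each cycle $t\ge1$ the process is observed at $q_t\ge1$ times of $[t,t+1)$, and $\widehat F_t$ is the empirical distribution function of these $q_t$ observations. For $n>p$ let $\widehat{\mathbb E}F_0=n^{-1}\sum_{t=1}^n\widehat F_t$ and $$\widehat C_k(x,y)=\frac1{n-p}\sum_{t=1}^{n-p}\big(\widehat F_t(x)-\widehat{\mathbb E}F_0(x)\big)\big(\widehat F_{t+k}(y)-\widehat{\mathbb E}F_0(y)\big),$$ let $\widehat R^\mu$ be the integral operator with kernel $\sum_{k=1}^p\int\widehat C_k(x,z)\widehat C_k(y,z)\,\mu(dz)$, with eigenvalues $\widehat\theta_1\ge\widehat\theta_2\ge\cdots\ge0$ (repeated by multiplicity)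 and orthonormal eigenfunctions $\widehat\psi_j$ (measurable in $\omega$) whose signs are chosen so that $\langle\widehat\psi_j,\psi_j\rangle\ge0$ whenever $\theta_j>0$. Put $\widehat W_{tj}=\langle\widehat F_t-\widehat{\mathbb E}F_0,\widehat\psi_j\rangle$, $1\le t\le n$. Statement. Assume that $n^{-1}\sum_{t=1}^n\xi_t\to\mathbb E\xi_0$ in probability (in the weak topology of probability measures), that $(\widehat F_t)_{t\ge1}$ is $\psi$-mixing with $\sum_{k\ge1}k\,\Psi(k)^{1/2}<\infty$, where $$\Psi(k)=\sup_{m\ge1}\ \sup\Big\{\Big|\tfrac{\mathbb P(A\cap B)}{\mathbb P(A)\mathbb P(B)}-1\Big|:A\in\sigma(\widehat F_1,\dots,\widehat F_m),\,B\in\sigma(\widehat F_{m+k},\widehat F_{m+k+1},\dots),\,\mathbb P(A)\mathbb P(B)>0\Big\},$$ and that the nonzero eigenvalues of $R^\mu$ are all distinct. Then for every $j$ with $\theta_j>0$, as $n\to\infty$: (i) $\mathbb E[\widehat W_{tj}\mid\Xi]=W_{tj}+O_{\mathbb P}(n^{-1/2})$; (ii) $|\widehat W_{tj}-W_{tj}|\le\|\widehat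 F_t-F_t\|+O_{\mathbb P}(n^{-1/2})$. Both hold uniformly in $1\le t\le n$: for each of (i) and (ii) there are random variables $r_n=O_{\mathbb P}(n^{-1/2})$, not depending on $t$, such that for all $n>p$ and $1\le t\le n$, almost surely, $|\mathbb E[\widehat W_{tj}\mid\Xi]-W_{tj}|\le r_n$, respectively $|\widehat W_{tj}-W_{tj}|\le\|\widehat F_t-F_t\|+r_n$. -/

import Mathlib

open MeasureTheory ProbabilityTheory Filter Topology Set
open scoped ENNReal NNReal RealInnerProductSpace

noncomputable section

/-! ### Stochastic order, mixing, conditional independence -/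

/-- `Y n = O_P(a n)` as `n → ∞`. -/
def IsBigOP {Ω : Type*} [MeasurableSpace Ω] (P : Measure Ω) (Y : ℕ → Ω → ℝ) (a : ℕ → ℝ) : Prop :=
  ∀ ε : ℝ, 0 < ε → ∃ M : ℝ, ∀ᶠ n in atTop, P {ω | M * a n < |Y n ω|} ≤ ENNReal.ofReal ε

/-- The `ψ`-dependence coefficient of two sub-σ-fields:
`sup |P(A ∩ B) / (P(A) P(B)) - 1|` over `A ∈ 𝓐`, `B ∈ 𝓑` of positive probability. -/
def psiDependence {Ω : Type*} [MeasurableSpace Ω] (P : Measure Ω) (𝓐 𝓑 : MeasurableSpace Ω) :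
    ℝ≥0∞ :=
  ⨆ (A : Set Ω) (_ : MeasurableSet[𝓐] A) (_ : P A ≠ 0)
    (B : Set Ω) (_ : MeasurableSet[𝓑] B) (_ : P B ≠ 0),
    ENNReal.ofReal |P.real (A ∩ B) / (P.real A * P.real B) - 1|

/-- The lag-`k` `ψ`-mixing coefficient of a sequence indexed by `t = 1, 2, …`, where `𝓖 t` is the
σ-field generated by its `t`-th term: the supremum over `m ≥ 1` of the `ψ`-dependence between the
past up to time `m` and the future from time `m + k` on. -/
def psiMixingCoeff {Ω : Type*} [MeasurableSpace Ω] (P : Measure Ω) (𝓖 : ℕ → MeasurableSpace Ω)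
    (k : ℕ) : ℝ≥0∞ :=
  ⨆ (m : ℕ) (_ : 1 ≤ m),
    psiDependence P (⨆ t ∈ Set.Icc 1 m, 𝓖 t) (⨆ t ∈ Set.Ici (m + k), 𝓖 t)

/-- Conditional independence given `𝓜` of a sequence of sub-σ-fields: the conditional
probability of a finite intersection is almost surely the product of the conditional
probabilities. -/
def CondIndepSeq {Ω : Type*} [mΩ : MeasurableSpace Ω] (P : Measure Ω) (𝓜 : MeasurableSpace Ω)
    (𝓖 : ℕ → MeasurableSpace Ω) : Prop :=
  ∀ (s : Finset ℕ) (A : ℕ → Set Ω), (∀ t ∈ s, MeasurableSet[𝓖 t] (A t)) →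
    P[(⋂ t ∈ s, A t).indicator (fun _ => (1 : ℝ)) | 𝓜]
      =ᵐ[P] ∏ t ∈ s, P[(A t).indicator (fun _ => (1 : ℝ)) | 𝓜]

/-! ### Integral operators on `L²(μ)` -/

/-- `g = K f` in `L²(μ)`, where `K` is the integral operator `K f (x) = ∫ K(x,y) f(y) μ(dy)`. -/
def IsIntegralImage (μ : Measure ℝ) (K : ℝ → ℝ → ℝ) (f g : Lp ℝ 2 μ) : Prop :=
  ∀ᵐ x ∂μ, g x = ∫ y, K x y * f y ∂μ

/-- The range in `L²(μ)` of the integral operator with kernel `K`. -/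
def kernelRange (μ : Measure ℝ) (K : ℝ → ℝ → ℝ) : Set (Lp ℝ 2 μ) :=
  {g | ∃ f : Lp ℝ 2 μ, IsIntegralImage μ K f g}

/-- The integral operators with kernels `K` and `L` have the same closed range. -/
def RangeEquivalent (μ : Measure ℝ) (K L : ℝ → ℝ → ℝ) : Prop :=
  closure (kernelRange μ K) = closure (kernelRange μ L)

/-- `θ` is the non-increasing sequence of eigenvalues (with repetitions) of the positive integral
operator with kernel `K`, and `ψ` is an orthonormal sequence of associated eigenfunctions. The last
field says that the list is exhaustive: every nonzero eigenvalue occurs with its full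
multiplicity. (The sequence then contains zeros if and only if the operator has finite rank.)
Indices start at `0`. -/
structure IsEigenSystem (μ : Measure ℝ) (K : ℝ → ℝ → ℝ) (θ : ℕ → ℝ) (ψ : ℕ → Lp ℝ 2 μ) :
    Prop where
  antitone : Antitone θ
  nonneg : ∀ j, 0 ≤ θ j
  orthonormal : Orthonormal ℝ ψ
  eigen : ∀ j, IsIntegralImage μ K (ψ j) (θ j • ψ j)
  exhaustive : ∀ (c : ℝ) (f : Lp ℝ 2 μ), c ≠ 0 → IsIntegralImage μ K f (c • f) →
    (∀ j, ⟪ψ j, f⟫ = 0) → f = 0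

/-! ### Conjugate processes -/

/-- A conjugate process: a sequence `ξ 0, ξ 1, …` of random Borel probability measures on `ℝ` and
a real process `(X τ)`, `τ ≥ 0`, such that
`P[X τ ∈ B | ξ 0, ξ 1, …] = ξ t (B)` whenever `τ ∈ [t, t + 1)`. -/
structure ConjugateProcess {Ω : Type*} [MeasurableSpace Ω] (P : Measure Ω) where
  ξ : ℕ → Ω → ProbabilityMeasure ℝ
  X : ℝ≥0 → Ω → ℝ
  measurable_ξ : ∀ t, Measurable (ξ t)
  measurable_X : ∀ τ, Measurable (X τ)
  compatible : ∀ (t : ℕ) (τ : ℝ≥0), τ ∈ Set.Ico (t : ℝ≥0) (t + 1) →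
    ∀ B : Set ℝ, MeasurableSet B →
      P[(X τ ⁻¹' B).indicator (fun _ => (1 : ℝ)) | ⨆ s, (inferInstance : MeasurableSpace
        (ProbabilityMeasure ℝ)).comap (ξ s)] =ᵐ[P] fun ω => (ξ t ω : Measure ℝ).real B

/-- A sampling scheme: in each cycle `t ≥ 1`, the process is observed `q t ≥ 1` times, at
`τ t 0, …, τ t (q t - 1) ∈ [t, t + 1)`. -/
structure SamplingScheme where
  q : ℕ → ℕ
  τ : ℕ → ℕ → ℝ≥0
  q_pos : ∀ t, 1 ≤ t → 1 ≤ q t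
  τ_mem : ∀ t, 1 ≤ t → ∀ i < q t, τ t i ∈ Set.Ico (t : ℝ≥0) (t + 1)

/-- The distribution function of a probability measure on `ℝ`. -/
def distFun (ν : ProbabilityMeasure ℝ) (x : ℝ) : ℝ := (ν : Measure ℝ).real (Set.Iic x)

theorem memLp_distFun (μ : Measure ℝ) [IsFiniteMeasure μ] (ν : ProbabilityMeasure ℝ) :
    MemLp (distFun ν) 2 μ := by
  have hm : Monotone (distFun ν) := fun x y h =>
    measureReal_mono (Set.Iic_subset_Iic.2 h)
  refine MemLp.of_bound hm.measurable.aestronglyMeasurable 1 (ae_of_all _ fun x => ?_)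
  rw [distFun, Real.norm_eq_abs, abs_of_nonneg measureReal_nonneg]
  exact measureReal_le_one

/-- The distribution function of `ν` as an element of `L²(μ)`. -/
def distL2 (μ : Measure ℝ) [IsFiniteMeasure μ] (ν : ProbabilityMeasure ℝ) : Lp ℝ 2 μ :=
  (memLp_distFun μ ν).toLp _

namespace ConjugateProcess

variable {Ω : Type*} [mΩ : MeasurableSpace Ω] {P : Measure Ω}

/-- `Ξ = σ(ξ 0, ξ 1, …)`. -/
@[reducible] def Xi (S : ConjugateProcess P) : MeasurableSpace Ω :=
  ⨆ s, (inferInstance : MeasurableSpace (ProbabilityMeasure ℝ)).comap (S.ξ s)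

/-- The latent process `(ξ t)` is (strictly) stationary. -/
def IsStationary (S : ConjugateProcess P) : Prop :=
  ∀ h : ℕ, IdentDistrib (fun ω (t : ℕ) => S.ξ (t + h) ω) (fun ω (t : ℕ) => S.ξ t ω) P P

/-- Given `Ξ`, the processes `(X τ : τ ∈ [t, t + 1))`, `t = 0, 1, …`, are independent. -/
def CyclicIndependent (S : ConjugateProcess P) : Prop :=
  CondIndepSeq P S.Xi fun t =>
    ⨆ τ ∈ Set.Ico (t : ℝ≥0) (t + 1), (borel ℝ).comap (S.X τ)

/-- The barycenter `E ξ 0`, that is, the measure `B ↦ E (ξ 0 (B))`. -/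
def meanMeasure [IsProbabilityMeasure P] (S : ConjugateProcess P) : ProbabilityMeasure ℝ :=
  ⟨P.bind fun ω => (S.ξ 0 ω : Measure ℝ),
    isProbabilityMeasure_bind (measurable_subtype_coe.comp (S.measurable_ξ 0)).aemeasurable
      (ae_of_all _ fun ω => (S.ξ 0 ω).2)⟩

/-- The defining property of the barycenter. -/
theorem integral_meanMeasure [IsProbabilityMeasure P] (S : ConjugateProcess P)
    (f : BoundedContinuousFunction ℝ ℝ) :
    ∫ x, f x ∂(S.meanMeasure : Measure ℝ) = ∫ ω, ∫ x, f x ∂(S.ξ 0 ω : Measure ℝ) ∂P := by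
  let κ : Kernel Ω ℝ := ⟨fun ω => (S.ξ 0 ω : Measure ℝ),
    measurable_subtype_coe.comp (S.measurable_ξ 0)⟩
  have hκ : IsMarkovKernel κ := ⟨fun ω => (S.ξ 0 ω).2⟩
  have h : (S.meanMeasure : Measure ℝ) = (κ ∘ₖ Kernel.const Unit P) () := by
    rw [Kernel.comp_apply, Kernel.const_apply]
    rfl
  rw [h, Kernel.integral_comp (f.integrable _), Kernel.const_apply]
  rfl

/-- The latent distribution function `F t (x) = ξ t (-∞, x]`. -/
def F (S : ConjugateProcess P) (t : ℕ) (ω : Ω) : ℝ → ℝ := distFun (S.ξ t ω)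

/-- `F t` as a random element of `L²(μ)`. -/
def FL2 (S : ConjugateProcess P) (μ : Measure ℝ) [IsFiniteMeasure μ] (t : ℕ) (ω : Ω) :
    Lp ℝ 2 μ := distL2 μ (S.ξ t ω)

/-- The mean function `E F 0` in `L²(μ)`. -/
def meanL2 [IsProbabilityMeasure P] (S : ConjugateProcess P) (μ : Measure ℝ)
    [IsFiniteMeasure μ] : Lp ℝ 2 μ := distL2 μ S.meanMeasure

/-- `μ` is a diffraction of `(ξ t)`: it is equivalent to Lebesgue measure on some interval
containing the support of `E ξ 0`. -/
def IsDiffraction [IsProbabilityMeasure P] (S : ConjugateProcess P) (μ : Measure ℝ) : Prop :=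
  ∃ I : Set ℝ, I.OrdConnected ∧ (S.meanMeasure : Measure ℝ).support ⊆ I ∧
    μ ≪ volume.restrict I ∧ volume.restrict I ≪ μ

/-- `n⁻¹ ∑_{t = 1}^n ξ t`. -/
def avgMeasure (S : ConjugateProcess P) (n : ℕ) (ω : Ω) : Measure ℝ :=
  (n : ℝ≥0∞)⁻¹ • ∑ t ∈ Finset.Icc 1 n, (S.ξ t ω : Measure ℝ)

/-- `n⁻¹ ∑_{t = 1}^n ξ t → E ξ 0` in probability, for the Lévy–Prokhorov metric. -/
def IsErgodicInProb [IsProbabilityMeasure P] (S : ConjugateProcess P) : Prop :=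
  ∀ ε : ℝ≥0∞, 0 < ε →
    Tendsto (fun n => P {ω | ε ≤ levyProkhorovEDist (S.avgMeasure n ω) S.meanMeasure})
      atTop (𝓝 0)

/-- The autocovariance function `C k (x, y) = Cov(F 0 (x), F k (y))`. -/
def C (S : ConjugateProcess P) (k : ℕ) (x y : ℝ) : ℝ :=
  cov[fun ω => S.F 0 ω x, fun ω => S.F k ω y; P]

/-- The kernel `R(x, y) = ∑_{k = 1}^p ∫ C k (x, z) C k (y, z) μ(dz)`. -/
def R (S : ConjugateProcess P) (μ : Measure ℝ) (p : ℕ) (x y : ℝ) : ℝ :=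
  ∑ k ∈ Finset.Icc 1 p, ∫ z, S.C k x z * S.C k y z ∂μ

/-- The empirical distribution function of the observations in cycle `t`. -/
def Fhat (S : ConjugateProcess P) (D : SamplingScheme) (t : ℕ) (ω : Ω) (x : ℝ) : ℝ :=
  (D.q t : ℝ)⁻¹ * ∑ i ∈ Finset.range (D.q t), (Set.Ici (S.X (D.τ t i) ω)).indicator 1 x

theorem memLp_Fhat (S : ConjugateProcess P) (D : SamplingScheme) (μ : Measure ℝ)
    [IsFiniteMeasure μ] (t : ℕ) (ω : Ω) : MemLp (S.Fhat D t ω) 2 μ := by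
  have h : ∀ i ∈ Finset.range (D.q t),
      MemLp (fun x => (Set.Ici (S.X (D.τ t i) ω)).indicator (1 : ℝ → ℝ) x) 2 μ := fun i _ =>
    memLp_indicator_const 2 measurableSet_Ici (1 : ℝ) (Or.inr (measure_ne_top _ _))
  exact (memLp_finsetSum (Finset.range (D.q t)) h).const_mul ((D.q t : ℝ)⁻¹)

/-- The empirical distribution function in `L²(μ)`. -/
def FhatL2 (S : ConjugateProcess P) (D : SamplingScheme) (μ : Measure ℝ) [IsFiniteMeasure μ]
    (t : ℕ) (ω : Ω) : Lp ℝ 2 μ := (S.memLp_Fhat D μ t ω).toLp _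

/-- The estimated mean function `n⁻¹ ∑_{t = 1}^n Fhat t`, pointwise. -/
def meanHat (S : ConjugateProcess P) (D : SamplingScheme) (n : ℕ) (ω : Ω) (x : ℝ) : ℝ :=
  (n : ℝ)⁻¹ * ∑ t ∈ Finset.Icc 1 n, S.Fhat D t ω x

/-- The estimated mean function in `L²(μ)`. -/
def meanHatL2 (S : ConjugateProcess P) (D : SamplingScheme) (μ : Measure ℝ) [IsFiniteMeasure μ]
    (n : ℕ) (ω : Ω) : Lp ℝ 2 μ :=
  (n : ℝ)⁻¹ • ∑ t ∈ Finset.Icc 1 n, S.FhatL2 D μ t ω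

/-- The sample autocovariance function (meaningful for `p < n`). -/
def Chat (S : ConjugateProcess P) (D : SamplingScheme) (p n k : ℕ) (ω : Ω) (x y : ℝ) : ℝ :=
  ((n : ℝ) - (p : ℝ))⁻¹ * ∑ t ∈ Finset.Icc 1 (n - p),
    (S.Fhat D t ω x - S.meanHat D n ω x) * (S.Fhat D (t + k) ω y - S.meanHat D n ω y)

/-- The kernel `Rhat(x, y) = ∑_{k = 1}^p ∫ Chat k (x, z) Chat k (y, z) μ(dz)`. -/
def Rhat (S : ConjugateProcess P) (D : SamplingScheme) (μ : Measure ℝ) (p n : ℕ) (ω : Ω)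
    (x y : ℝ) : ℝ :=
  ∑ k ∈ Finset.Icc 1 p, ∫ z, S.Chat D p n k ω x z * S.Chat D p n k ω y z ∂μ

/-- The σ-field generated by the random function `Fhat t`. -/
@[reducible] def sigmaFhat (S : ConjugateProcess P) (D : SamplingScheme) (t : ℕ) : MeasurableSpace Ω :=
  ⨆ x : ℝ, (borel ℝ).comap fun ω => S.Fhat D t ω x

/-- `(Fhat t)`, `t ≥ 1`, is `ψ`-mixing, with coefficients `Ψ k` such that
`∑_{k ≥ 1} k Ψ(k)^{1/2} < ∞`. -/
def IsPsiMixing (S : ConjugateProcess P) (D : SamplingScheme) : Prop :=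
  Tendsto (psiMixingCoeff P (S.sigmaFhat D)) atTop (𝓝 0) ∧
    ∑' k : ℕ, ((k + 1 : ℕ) : ℝ≥0∞) * psiMixingCoeff P (S.sigmaFhat D) (k + 1) ^ (1 / 2 : ℝ) < ∞

/-- The latent score `W_t = ⟨F t - E F 0, ψ⟩` along `ψ`. -/
def W [IsProbabilityMeasure P] (S : ConjugateProcess P) {μ : Measure ℝ} [IsFiniteMeasure μ]
    (ψ : Lp ℝ 2 μ) (t : ℕ) (ω : Ω) : ℝ :=
  ⟪S.FL2 μ t ω - S.meanL2 μ, ψ⟫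

/-- The estimated score `⟨Fhat t - Ehat F 0, ψ⟩` along the random element `ψ`, computed from the
cycles `1, …, n`. -/
def What (S : ConjugateProcess P) (D : SamplingScheme) {μ : Measure ℝ} [IsFiniteMeasure μ]
    (n : ℕ) (ψ : Ω → Lp ℝ 2 μ) (t : ℕ) (ω : Ω) : ℝ :=
  ⟪S.FhatL2 D μ t ω - S.meanHatL2 D μ n ω, ψ ω⟫

end ConjugateProcess

end

/-! Distribution functions take values in `[0, 1]`, so their norms in `L²(μ)` are at most `c =
√μ(ℝ)`. By bilinearity of the inner product, the error of an estimated score, apart from the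
sampling error of its own cycle, is at most `Z n = 2c‖ψhat j - ψ j‖ + ‖meanHat - mean‖`. This bound
does not involve `t`, which gives the uniformity. For (ii) the remainder is `Z n` itself. For (i) it
is `E[Z n | Ξ]`: the score of `Fhat t` along the fixed direction `ψ j`, centred at the true mean,
has conditional expectation exactly `W`. It remains to show that both summands of `Z n` have
expectation `O(n^{-1/2})`; conditional expectation contracts `L¹`, and Markov's inequality turns
such a rate into `O_P`.

Moments. Given `Ξ`, `Fhat t` is unbiased for `F t`, and observations from distinct cycles are
independent. With stationarity, `Fhat t (x)` and, for `k ≥ 1`, `Fhat t (x) * Fhat (t + k) (y)`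
therefore have the means `E F 0 (x)` and `E[F 0 (x) F k (y)]` for every `t ≥ 1`, whatever the
numbers of observations. Mixing bounds the covariances at large lags by a summable sequence
(`exists_integral_sq_avg_sub_le`), so averages over `N` cycles have mean square error at most `B /
N`, with `B` independent of `x` and `y`. Integrating over the finite measure `μ` gives the rate
`1/n` for the squared error of the mean and for the squared Hilbert–Schmidt distance of `Rhat` and
`R` (`exists_mse_Rhat_le`).

Spectrum. The operators are compact, symmetric and have nonnegative eigenvalues, and `θ j` is
simple. Weyl's inequality and the spectral gap at `θ j` give the deterministic estimate `‖ψhat j - ψ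
j‖ ≤ C‖Rhat - R‖` (`exists_norm_eigenvector_sub_le`), with no smallness condition: for a large
perturbation the distance of two unit vectors is trivially bounded. -/

/-! ### Perturbation of eigenvalues and eigenvectors of compact symmetric operators -/

section Spectral

variable {H : Type*} [NormedAddCommGroup H] [InnerProductSpace ℝ H] [CompleteSpace H]

/-- A compact self-adjoint operator without nonzero eigenvalues vanishes. -/
theorem eq_zero_of_compact_of_no_eigenvalue {T : H →L[ℝ] H} (hc : IsCompactOperator T)
    (hs : IsSelfAdjoint T) (h : ∀ (c : ℝ) (f : H), c ≠ 0 → T f = c • f → f = 0) : T = 0 := by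
  have hr := T.spectralRadius_eq_nnnorm hs
  -- For a self-adjoint operator the norm is the spectral radius, and by the Fredholm alternative
  -- the nonzero spectrum of a compact operator consists of eigenvalues.
  have h0 : spectralRadius ℝ T = 0 := by
    refine le_antisymm (iSup₂_le fun c hcs => ?_) bot_le
    by_cases hc0 : c = 0
    · simp [hc0]
    · have he := (hc.hasEigenvalue_iff_mem_spectrum hc0).2 hcs
      obtain ⟨f, hf⟩ := he.exists_hasEigenvector
      exact absurd (h c f hc0 hf.apply_eq_smul) hf.2
  rw [h0] at hr
  simpa using hr.symm

/-- An orthonormal family of eigenvectors of a compact symmetric operator that is exhaustive for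
the nonzero eigenvalues extends to a Hilbert basis of eigenvectors. -/
theorem exists_hilbertBasis_of_exhaustive {T : H →L[ℝ] H} (hc : IsCompactOperator T)
    (hs : ∀ f g, ⟪T f, g⟫ = ⟪f, T g⟫) {θ : ℕ → ℝ} {ψ : ℕ → H} (ho : Orthonormal ℝ ψ)
    (he : ∀ j, T (ψ j) = θ j • ψ j)
    (hex : ∀ (c : ℝ) (f : H), c ≠ 0 → T f = c • f → (∀ j, ⟪ψ j, f⟫ = 0) → f = 0) :
    ∃ (w : Set H) (b : HilbertBasis w ℝ H) (κ : w → ℝ), (∀ i, T (b i) = κ i • b i) ∧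
      ∀ i, (∃ j, b i = ψ j ∧ κ i = θ j) ∨ ((∀ j, ⟪ψ j, b i⟫ = 0) ∧ κ i = 0) := by
  let V : Submodule ℝ H := (Submodule.span ℝ (Set.range ψ))ᗮ
  have hV : ∀ f, f ∈ V ↔ ∀ j, ⟪ψ j, f⟫ = 0 := by
    intro f
    refine ⟨fun h j => (Submodule.mem_orthogonal _ _).1 h _ (Submodule.subset_span ⟨j, rfl⟩),
      fun h => (Submodule.mem_orthogonal _ _).2 fun u hu => ?_⟩
    induction hu using Submodule.span_induction with
    | mem x hx => obtain ⟨j, rfl⟩ := hx; exact h j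
    | zero => simp
    | add x y _ _ hx hy => rw [inner_add_left, hx, hy, add_zero]
    | smul a x _ hx => rw [real_inner_smul_left, hx, mul_zero]
  have hinv : ∀ f ∈ V, T f ∈ V := by
    intro f hf
    rw [hV] at hf ⊢
    intro j
    rw [← hs, he, real_inner_smul_left, hf, mul_zero]
  -- The restriction of `T` to the invariant complement `V` is again compact and symmetric; an
  -- eigenvector there with nonzero eigenvalue would contradict exhaustiveness.
  have hT0 : ∀ f ∈ V, T f = 0 := by
    let S : V →L[ℝ] V := (T.comp V.subtypeL).codRestrict V fun f => hinv f f.2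
    have hSc : IsCompactOperator S :=
      (hc.comp_clm V.subtypeL).codRestrict (fun f => hinv f f.2)
        (Submodule.isClosed_orthogonal _)
    have hSs : IsSelfAdjoint S := by
      rw [ContinuousLinearMap.isSelfAdjoint_iff_isSymmetric]
      intro f g
      exact hs f g
    have hS := eq_zero_of_compact_of_no_eigenvalue hSc hSs fun c f hc0 hf => by
      have := hex c f hc0 (congrArg Subtype.val hf) ((hV f).1 f.2)
      exact Subtype.ext this
    intro f hf
    exact congrArg Subtype.val (DFunLike.congr_fun hS (⟨f, hf⟩ : V))
  obtain ⟨w, b, hw, hb⟩ := ho.toSubtypeRange.exists_hilbertBasis_extension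
  have key : ∀ i : w, ∃ k : ℝ, T (b i) = k • b i ∧
      ((∃ j, b i = ψ j ∧ k = θ j) ∨ ((∀ j, ⟪ψ j, b i⟫ = 0) ∧ k = 0)) := by
    intro i
    by_cases hi : ∃ j, b i = ψ j
    · obtain ⟨j, hj⟩ := hi
      exact ⟨θ j, by rw [hj, he], Or.inl ⟨j, hj, rfl⟩⟩
    · have hperp : ∀ j, ⟪ψ j, b i⟫ = 0 := by
        intro j
        have hjw : ψ j ∈ w := hw ⟨j, rfl⟩
        have h1 : b ⟨ψ j, hjw⟩ = ψ j := by rw [hb]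
        rw [← h1]
        refine b.orthonormal.2 fun h => hi ⟨j, ?_⟩
        rw [← h, h1]
      exact ⟨0, by rw [hT0 _ ((hV _).2 hperp), zero_smul], Or.inr ⟨hperp, rfl⟩⟩
  choose κ hκ using key
  exact ⟨w, b, κ, fun i => (hκ i).1, fun i => (hκ i).2⟩

/-- The Rayleigh quotient bound on the orthogonal complement of the first `j` eigenvectors. -/
theorem inner_apply_le_of_perp {T : H →L[ℝ] H} (hc : IsCompactOperator T)
    (hs : ∀ f g, ⟪T f, g⟫ = ⟪f, T g⟫) {θ : ℕ → ℝ} {ψ : ℕ → H} (ho : Orthonormal ℝ ψ)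
    (he : ∀ j, T (ψ j) = θ j • ψ j) (ha : Antitone θ) (h0 : ∀ j, 0 ≤ θ j)
    (hex : ∀ (c : ℝ) (f : H), c ≠ 0 → T f = c • f → (∀ j, ⟪ψ j, f⟫ = 0) → f = 0)
    (j : ℕ) (f : H) (hf : ∀ i < j, ⟪ψ i, f⟫ = 0) : ⟪f, T f⟫ ≤ θ j * ‖f‖ ^ 2 := by
  obtain ⟨w, b, κ, hκ, hcase⟩ := exists_hilbertBasis_of_exhaustive hc hs ho he hex
  have h1 := b.hasSum_inner_mul_inner f (T f)
  have h2 := (b.hasSum_inner_mul_inner f f).mul_left (θ j)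
  rw [real_inner_self_eq_norm_sq] at h2
  refine hasSum_le (fun i => ?_) h1 h2
  rw [← hs (b i) f, hκ, real_inner_smul_left, real_inner_comm (b i) f]
  -- Eigenvalues exceeding `θ j` can only sit at indices below `j`, where `f` has no component.
  have hle : κ i ≤ θ j ∨ ⟪b i, f⟫ = 0 := by
    rcases hcase i with ⟨l, hl, hk⟩ | ⟨-, hk⟩
    · rcases lt_or_ge l j with h | h
      · right; rw [hl, hf l h]
      · left; rw [hk]; exact ha h
    · left; rw [hk]; exact h0 j
  rcases hle with h | h
  · nlinarith [mul_le_mul_of_nonneg_right h (mul_self_nonneg ⟪b i, f⟫)]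
  · rw [h]; simp

/-- **Weyl's inequality** for the eigenvalues of two operators, the first one compact and
symmetric. -/
theorem eigenvalue_le_add {T T' : H →L[ℝ] H} (hc : IsCompactOperator T)
    (hs : ∀ f g, ⟪T f, g⟫ = ⟪f, T g⟫) {θ θ' : ℕ → ℝ} {ψ ψ' : ℕ → H} (ho : Orthonormal ℝ ψ)
    (he : ∀ j, T (ψ j) = θ j • ψ j) (ha : Antitone θ) (h0 : ∀ j, 0 ≤ θ j)
    (hex : ∀ (c : ℝ) (f : H), c ≠ 0 → T f = c • f → (∀ j, ⟪ψ j, f⟫ = 0) → f = 0)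
    (ho' : Orthonormal ℝ ψ') (he' : ∀ j, T' (ψ' j) = θ' j • ψ' j) (ha' : Antitone θ')
    {δ : ℝ} (hδ : ∀ f, ‖T f - T' f‖ ≤ δ * ‖f‖) (j : ℕ) : θ' j ≤ θ j + δ := by
  -- Dimension count: `j + 1` coefficients against `j` conditions give a nonzero `f` in the span of
  -- `ψ' 0, …, ψ' j` orthogonal to `ψ 0, …, ψ (j - 1)`. Its Rayleigh quotient is at least `θ' j` for
  -- `T'` and at most `θ j` for `T`.
  let A : (Fin (j + 1) → ℝ) →ₗ[ℝ] (Fin j → ℝ) :=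
    { toFun := fun c i => ∑ l : Fin (j + 1), c l * ⟪ψ i, ψ' l⟫
      map_add' := fun c d => by
        ext i; simp [add_mul, Finset.sum_add_distrib]
      map_smul' := fun a c => by
        ext i; simp [mul_assoc, Finset.mul_sum] }
  have hker : LinearMap.ker A ≠ ⊥ := LinearMap.ker_ne_bot_of_finrank_lt (by simp)
  obtain ⟨c, hcA, hc0⟩ := Submodule.exists_mem_ne_zero_of_ne_bot hker
  have hoj : Orthonormal ℝ fun l : Fin (j + 1) => ψ' l :=
    ho'.comp _ Fin.val_injective
  set f : H := ∑ l : Fin (j + 1), c l • ψ' l with hfdef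
  have hnorm : ‖f‖ ^ 2 = ∑ l, c l ^ 2 := by
    rw [← real_inner_self_eq_norm_sq, hfdef, hoj.inner_sum]
    simp [sq]
  have hTf : T' f = ∑ l : Fin (j + 1), (c l * θ' l) • ψ' l := by
    rw [hfdef, map_sum]
    simp [he', smul_smul]
  have hlow : θ' j * ‖f‖ ^ 2 ≤ ⟪f, T' f⟫ := by
    rw [hnorm, hTf, hfdef, hoj.inner_sum, Finset.mul_sum]
    refine Finset.sum_le_sum fun l _ => ?_
    have := ha' (Nat.lt_succ_iff.1 l.2)
    simp only [conj_trivial]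
    nlinarith [mul_le_mul_of_nonneg_right this (sq_nonneg (c l))]
  have hpos : 0 < ‖f‖ ^ 2 := by
    rw [hnorm]
    obtain ⟨l, hl⟩ := Function.ne_iff.1 hc0
    exact Finset.sum_pos' (fun _ _ => sq_nonneg _)
      ⟨l, Finset.mem_univ _, by have : c l ≠ 0 := hl; positivity⟩
  have hperp : ∀ i < j, ⟪ψ i, f⟫ = 0 := by
    intro i hi
    have := congrFun (LinearMap.mem_ker.1 hcA) ⟨i, hi⟩
    rw [hfdef, inner_sum]
    simpa [real_inner_smul_right, A] using this
  have hup := inner_apply_le_of_perp hc hs ho he ha h0 hex j f hperp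
  have hdiff : ⟪f, T' f⟫ - ⟪f, T f⟫ ≤ δ * ‖f‖ ^ 2 := by
    rw [← inner_sub_right]
    refine (real_inner_le_norm _ _).trans ?_
    rw [norm_sub_rev]
    nlinarith [mul_le_mul_of_nonneg_left (hδ f) (norm_nonneg f)]
  nlinarith

/-- **Perturbation of a simple eigenvector** of a compact symmetric operator. -/
theorem exists_norm_eigenvector_sub_le {T : H →L[ℝ] H} (hc : IsCompactOperator T)
    (hs : ∀ f g, ⟪T f, g⟫ = ⟪f, T g⟫) {θ : ℕ → ℝ} {ψ : ℕ → H} (ho : Orthonormal ℝ ψ)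
    (he : ∀ j, T (ψ j) = θ j • ψ j) (ha : Antitone θ) (h0 : ∀ j, 0 ≤ θ j)
    (hex : ∀ (c : ℝ) (f : H), c ≠ 0 → T f = c • f → (∀ j, ⟪ψ j, f⟫ = 0) → f = 0)
    (hd : ∀ i j, θ i ≠ 0 → θ i = θ j → i = j) (j : ℕ) (hj : 0 < θ j) :
    ∃ C : ℝ, 0 ≤ C ∧ ∀ (T' : H →L[ℝ] H) (θ' : ℕ → ℝ) (ψ' : ℕ → H) (δ : ℝ), IsCompactOperator T' →
      (∀ f g, ⟪T' f, g⟫ = ⟪f, T' g⟫) → Orthonormal ℝ ψ' → (∀ j, T' (ψ' j) = θ' j • ψ' j) →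
      Antitone θ' → (∀ j, 0 ≤ θ' j) →
      (∀ (c : ℝ) (f : H), c ≠ 0 → T' f = c • f → (∀ j, ⟪ψ' j, f⟫ = 0) → f = 0) →
      (∀ f, ‖T f - T' f‖ ≤ δ * ‖f‖) → 0 ≤ ⟪ψ' j, ψ j⟫ → ‖ψ' j - ψ j‖ ≤ C * δ := by
  obtain ⟨w, b, κ, hκ, hcase⟩ := exists_hilbertBasis_of_exhaustive hc hs ho he hex
  -- By monotonicity only the neighbours `θ (j - 1)` and `θ (j + 1)` matter. Basis vectors outside
  -- the family `ψ` have eigenvalue `0 ≤ θ (j + 1)`, so they are no closer. The factor `2` leaves a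
  -- gap `γ` after `θ j` moves by at most `γ`.
  obtain ⟨γ, hγ, hgap⟩ : ∃ γ : ℝ, 0 < γ ∧ ∀ i, b i ≠ ψ j → 2 * γ ≤ |κ i - θ j| := by
    have hsucc : θ (j + 1) < θ j := lt_of_le_of_ne (ha (Nat.le_succ j)) fun h => by
      have := hd j (j + 1) hj.ne' h.symm
      omega
    obtain ⟨γ₁, hγ₁, hprev⟩ : ∃ γ₁ : ℝ, 0 < γ₁ ∧ ∀ l < j, γ₁ ≤ θ l - θ j := by
      rcases Nat.eq_zero_or_pos j with h | h
      · exact ⟨1, one_pos, fun l hl => by omega⟩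
      · refine ⟨θ (j - 1) - θ j, sub_pos.2 (lt_of_le_of_ne (ha (Nat.sub_le _ _)) fun e => ?_),
          fun l hl => sub_le_sub_right (ha (by omega)) _⟩
        have := hd j (j - 1) hj.ne' e
        omega
    refine ⟨min γ₁ (θ j - θ (j + 1)) / 2, by have := sub_pos.2 hsucc; positivity, fun i hi => ?_⟩
    have hm1 := min_le_left γ₁ (θ j - θ (j + 1))
    have hm2 := min_le_right γ₁ (θ j - θ (j + 1))
    rcases hcase i with ⟨l, hl, hk⟩ | ⟨-, hk⟩
    · rw [hk]
      rcases lt_trichotomy l j with h | h | h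
      · have := hprev l h
        rw [le_abs]; left; linarith
      · exact absurd (h ▸ hl) hi
      · have := ha (Nat.succ_le_of_lt h)
        rw [le_abs]; right; simp only [Nat.succ_eq_add_one] at this; linarith
    · rw [hk, le_abs]; right; have := h0 (j + 1); linarith
  refine ⟨2 / γ, by positivity, fun T' θ' ψ' δ hc' hs' ho' he' ha' h0' hex' hδ hsign => ?_⟩
  have hδ0 : 0 ≤ δ := by
    have := (norm_nonneg _).trans (hδ (ψ j))
    rwa [ho.1 j, mul_one] at this
  set φ := ψ' j with hφ
  have hφ1 : ‖φ‖ = 1 := ho'.1 j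
  have hψ1 : ‖ψ j‖ = 1 := ho.1 j
  have hsq : ‖φ - ψ j‖ ^ 2 = 2 - 2 * ⟪φ, ψ j⟫ := by
    rw [norm_sub_sq_real, hφ1, hψ1]; ring
  have hle1 : ⟪φ, ψ j⟫ ≤ 1 := by
    have := real_inner_le_norm φ (ψ j); rwa [hφ1, hψ1, one_mul] at this
  -- If `δ > γ`, unit vectors are at distance at most `2 ≤ (2 / γ) * δ`, and nothing else is needed.
  rcases lt_or_ge γ δ with hbig | hsmall
  · have h1 : ‖φ - ψ j‖ ≤ 2 := by
      have := norm_sub_le φ (ψ j); rw [hφ1, hψ1] at this; linarith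
    refine h1.trans ?_
    rw [div_mul_eq_mul_div, le_div_iff₀ hγ]; linarith
  have hW1 := eigenvalue_le_add hc hs ho he ha h0 hex ho' he' ha' hδ j
  have hW2 := eigenvalue_le_add hc' hs' ho' he' ha' h0' hex' ho he ha
    (fun f => by rw [norm_sub_rev]; exact hδ f) j
  set e := T φ - θ' j • φ with hedef
  have hen : ‖e‖ ≤ δ := by
    have := hδ φ
    rwa [hφ, he' j, ← hφ, hφ1, mul_one] at this
  -- `φ` is an approximate eigenvector of `T` with residual `e`. Away from `ψ j` its coefficients
  -- are those of `e` divided by numbers of modulus at least `γ`, whence `γ‖g‖ ≤ ‖e‖ ≤ δ`.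
  have hcoef : ∀ i, (κ i - θ' j) * ⟪b i, φ⟫ = ⟪b i, e⟫ := by
    intro i
    rw [hedef, inner_sub_right, ← hs, hκ, real_inner_smul_left, real_inner_smul_right]; ring
  -- the component of `φ` orthogonal to `ψ j`
  set g := φ - ⟪ψ j, φ⟫ • ψ j with hgdef
  have hgi : ∀ i, γ ^ 2 * ⟪b i, g⟫ ^ 2 ≤ ⟪b i, e⟫ ^ 2 := by
    intro i
    by_cases hi : b i = ψ j
    · have : ⟪b i, g⟫ = 0 := by
        rw [hi, hgdef, inner_sub_right, real_inner_smul_right, real_inner_self_eq_norm_sq, hψ1]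
        ring
      rw [this]; simp [sq_nonneg]
    · have hperp : ⟪b i, ψ j⟫ = 0 := by
        rcases hcase i with ⟨l, hl, -⟩ | ⟨h, -⟩
        · rw [hl]
          exact ho.2 fun h => hi (h ▸ hl)
        · rw [real_inner_comm, h]
      have hg : ⟪b i, g⟫ = ⟪b i, φ⟫ := by
        rw [hgdef, inner_sub_right, real_inner_smul_right, hperp]; ring
      have hk : γ ≤ |κ i - θ' j| := by
        have h1 := hgap i hi
        have h2 : |κ i - θ j| ≤ |κ i - θ' j| + |θ' j - θ j| := abs_sub_le _ _ _
        have h3 : |θ' j - θ j| ≤ δ := abs_le.2 ⟨by linarith, by linarith⟩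
        linarith
      rw [hg, ← hcoef i, mul_pow, ← sq_abs (κ i - θ' j)]
      gcongr
  have hgn : γ ^ 2 * ‖g‖ ^ 2 ≤ ‖e‖ ^ 2 := by
    have h1 := (b.hasSum_inner_mul_inner g g).mul_left (γ ^ 2)
    have h2 := b.hasSum_inner_mul_inner e e
    rw [real_inner_self_eq_norm_sq] at h1 h2
    refine hasSum_le (fun i => ?_) h1 h2
    rw [real_inner_comm (b i) g, real_inner_comm (b i) e, ← sq, ← sq]
    exact hgi i
  have hg2 : ‖g‖ ^ 2 = 1 - ⟪φ, ψ j⟫ ^ 2 := by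
    rw [hgdef, norm_sub_sq_real, norm_smul, real_inner_smul_right, hφ1, hψ1, real_inner_comm φ,
      Real.norm_eq_abs, mul_one, sq_abs]
    ring
  have hfin : γ ^ 2 * ‖φ - ψ j‖ ^ 2 ≤ (2 * δ) ^ 2 := by
    -- With `a = ⟪φ, ψ j⟫` this reads `2 - 2a ≤ 2(1 - a²)`, true because `0 ≤ a ≤ 1`; this is where
    -- the choice of sign is used.
    have h1 : ‖φ - ψ j‖ ^ 2 ≤ 2 * ‖g‖ ^ 2 := by
      rw [hsq, hg2]; nlinarith
    have h2 : ‖e‖ ^ 2 ≤ δ ^ 2 := by gcongr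
    nlinarith [mul_le_mul_of_nonneg_left h1 (sq_nonneg γ), sq_nonneg δ]
  rw [← mul_pow] at hfin
  have := abs_le_of_sq_le_sq hfin (by positivity)
  rw [div_mul_eq_mul_div, le_div_iff₀ hγ]
  linarith [le_abs_self (γ * ‖φ - ψ j‖), this]

end Spectral

/-! ### Bounded measurable functions and their classes in `L²` -/

section BddMeasurable

/-- Bounded measurable real functions. -/
def BddMeasurable {α : Type*} [MeasurableSpace α] (f : α → ℝ) : Prop :=
  Measurable f ∧ ∃ B : ℝ, ∀ a, |f a| ≤ B

namespace BddMeasurable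

variable {α β : Type*} [MeasurableSpace α] [MeasurableSpace β] {f g : α → ℝ}

theorem const (c : ℝ) : BddMeasurable fun _ : α => c := ⟨measurable_const, |c|, fun _ => le_rfl⟩

theorem add (hf : BddMeasurable f) (hg : BddMeasurable g) : BddMeasurable fun a => f a + g a := by
  obtain ⟨hf, B, hB⟩ := hf
  obtain ⟨hg, D, hD⟩ := hg
  exact ⟨hf.add hg, B + D, fun a => (abs_add_le _ _).trans (add_le_add (hB a) (hD a))⟩

theorem neg (hf : BddMeasurable f) : BddMeasurable fun a => -f a :=
  ⟨hf.1.neg, hf.2.imp fun B hB a => by rw [abs_neg]; exact hB a⟩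

theorem sub (hf : BddMeasurable f) (hg : BddMeasurable g) : BddMeasurable fun a => f a - g a := by
  simpa only [sub_eq_add_neg] using hf.add hg.neg

theorem mul (hf : BddMeasurable f) (hg : BddMeasurable g) : BddMeasurable fun a => f a * g a := by
  obtain ⟨hf, B, hB⟩ := hf
  obtain ⟨hg, D, hD⟩ := hg
  refine ⟨hf.mul hg, B * D, fun a => ?_⟩
  rw [abs_mul]
  exact mul_le_mul (hB a) (hD a) (abs_nonneg _) ((abs_nonneg _).trans (hB a))

theorem sq (hf : BddMeasurable f) : BddMeasurable fun a => f a ^ 2 := by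
  simpa only [_root_.sq] using hf.mul hf

theorem finset_sum {ι : Type*} {F : ι → α → ℝ} (s : Finset ι) (h : ∀ i ∈ s, BddMeasurable (F i)) :
    BddMeasurable fun a => ∑ i ∈ s, F i a := by
  classical
  induction s using Finset.induction_on with
  | empty => simpa using const (α := α) 0
  | insert i s hi ih =>
    simp only [Finset.sum_insert hi]
    exact (h i (Finset.mem_insert_self i s)).add
      (ih fun l hl => h l (Finset.mem_insert_of_mem hl))

theorem comp (hf : BddMeasurable f) {φ : β → α} (hφ : Measurable φ) :
    BddMeasurable fun b => f (φ b) :=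
  ⟨hf.1.comp hφ, hf.2.imp fun _ hB b => hB (φ b)⟩

theorem integrable (hf : BddMeasurable f) (μ : Measure α) [IsFiniteMeasure μ] :
    Integrable f μ := by
  obtain ⟨hf, B, hB⟩ := hf
  exact Integrable.of_bound hf.aestronglyMeasurable B (ae_of_all _ hB)

theorem memLp (hf : BddMeasurable f) (μ : Measure α) [IsFiniteMeasure μ] (p : ℝ≥0∞) :
    MemLp f p μ := by
  obtain ⟨hf, B, hB⟩ := hf
  exact MemLp.of_bound hf.aestronglyMeasurable B (ae_of_all _ hB)

theorem integral_right {F : α → β → ℝ} (hF : BddMeasurable fun z : α × β => F z.1 z.2)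
    (μ : Measure β) [IsFiniteMeasure μ] : BddMeasurable fun a => ∫ b, F a b ∂μ := by
  obtain ⟨hF, B, hB⟩ := hF
  refine ⟨(StronglyMeasurable.integral_prod_right' (f := fun z : α × β => F z.1 z.2)
    hF.stronglyMeasurable).measurable, B * μ.real univ, fun a => ?_⟩
  exact norm_integral_le_of_norm_le_const (f := F a) (ae_of_all _ fun b => hB (a, b))

end BddMeasurable

/-- Cauchy–Schwarz inequality against the constant function `1`. -/
theorem sq_integral_le_measure_mul {α : Type*} [MeasurableSpace α] (μ : Measure α)
    [IsFiniteMeasure μ] {f : α → ℝ} (hf : BddMeasurable f) :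
    (∫ a, f a ∂μ) ^ 2 ≤ μ.real univ * ∫ a, f a ^ 2 ∂μ := by
  rcases eq_or_ne μ 0 with rfl | hμ
  · simp
  have hM : 0 < μ.real univ := by
    exact ENNReal.toReal_pos (by simpa using hμ) (measure_ne_top _ _)
  set M := μ.real univ
  set I := ∫ a, f a ∂μ
  -- Up to the factor `M ^ 2`, the integrated squared deviation of `f` from its average `I / M`.
  have h0 : 0 ≤ ∫ a, (M * f a - I) ^ 2 ∂μ := integral_nonneg fun a => sq_nonneg _
  have h1 : ∫ a, (M * f a - I) ^ 2 ∂μ = M * (M * (∫ a, f a ^ 2 ∂μ) - I ^ 2) := by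
    have he : ∀ a, (M * f a - I) ^ 2 = M ^ 2 * f a ^ 2 - 2 * M * I * f a + I ^ 2 := fun a => by ring
    simp_rw [he]
    rw [integral_add, integral_sub, integral_const_mul, integral_const_mul, integral_const,
      smul_eq_mul]
    · ring
    · exact (hf.sq.integrable μ).const_mul _
    · exact (hf.integrable μ).const_mul _
    · exact ((hf.sq.integrable μ).const_mul _).sub ((hf.integrable μ).const_mul _)
    · exact integrable_const _
  rw [h1] at h0
  have := nonneg_of_mul_nonneg_right h0 hM
  linarith

/-- The `L²` norm of the class of a bounded measurable function. -/
theorem norm_toLp_sq {α : Type*} [MeasurableSpace α] {μ : Measure α} {f : α → ℝ}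
    (hf : MemLp f 2 μ) : ‖hf.toLp f‖ ^ 2 = ∫ a, f a ^ 2 ∂μ := by
  rw [← real_inner_self_eq_norm_sq, L2.inner_def]
  refine integral_congr_ae ?_
  filter_upwards [hf.coeFn_toLp] with a ha
  simp [ha, sq]

theorem norm_Lp_sq {α : Type*} [MeasurableSpace α] {μ : Measure α} (g : Lp ℝ 2 μ) :
    ‖g‖ ^ 2 = ∫ a, g a ^ 2 ∂μ := by
  rw [← real_inner_self_eq_norm_sq, L2.inner_def]
  simp [sq]

theorem inner_toLp_left {α : Type*} [MeasurableSpace α] {μ : Measure α} {f : α → ℝ}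
    (hf : MemLp f 2 μ) (g : Lp ℝ 2 μ) : ⟪hf.toLp f, g⟫ = ∫ a, f a * g a ∂μ := by
  rw [L2.inner_def]
  refine integral_congr_ae ?_
  filter_upwards [hf.coeFn_toLp] with a ha
  simp [ha, mul_comm]

theorem integrable_sq_Lp {α : Type*} [MeasurableSpace α] {μ : Measure α} (g : Lp ℝ 2 μ) :
    Integrable (fun a => g a ^ 2) μ := (Lp.memLp g).integrable_sq

theorem integrable_Lp {α : Type*} [MeasurableSpace α] {μ : Measure α} [IsFiniteMeasure μ]
    (g : Lp ℝ 2 μ) : Integrable g μ := (Lp.memLp g).integrable (by norm_num)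

/-- A jointly measurable bounded function is strongly measurable as a map into `L²`. -/
theorem stronglyMeasurable_toLp {α : Type*} [MeasurableSpace α] {μ : Measure ℝ}
    [IsFiniteMeasure μ] {F : α → ℝ → ℝ} (hF : BddMeasurable fun z : α × ℝ => F z.1 z.2)
    (h : ∀ a, MemLp (F a) 2 μ) : StronglyMeasurable fun a => (h a).toLp (F a) := by
  borelize ↥(Lp ℝ 2 μ)
  have : Fact ((2 : ℝ≥0∞) ≠ ∞) := ⟨by norm_num⟩
  refine Measurable.stronglyMeasurable ?_
  -- The squared distance to a fixed `g` is a parametric integral, hence measurable, so balls have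
  -- measurable preimages. By separability of `L²(μ)` every open set is a countable union of balls.
  have hball : ∀ (g : Lp ℝ 2 μ) (r : ℝ), 0 < r →
      MeasurableSet ((fun a => (h a).toLp (F a)) ⁻¹' Metric.ball g r) := by
    intro g r hr
    have hm : Measurable fun a => ∫ x, (F a x - g x) ^ 2 ∂μ := by
      refine (StronglyMeasurable.integral_prod_right'
        (f := fun z : α × ℝ => (F z.1 z.2 - g z.2) ^ 2) ?_).measurable
      exact ((hF.1.sub ((Lp.stronglyMeasurable g).measurable.comp measurable_snd)).pow_const
        2).stronglyMeasurable
    have he : (fun a => (h a).toLp (F a)) ⁻¹' Metric.ball g r =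
        {a | ∫ x, (F a x - g x) ^ 2 ∂μ < r ^ 2} := by
      ext a
      rw [Set.mem_preimage, Metric.mem_ball, dist_eq_norm, Set.mem_ofPred_eq,
        ← sq_lt_sq₀ (norm_nonneg _) hr.le, norm_Lp_sq]
      have : ∫ x, ((h a).toLp (F a) - g : Lp ℝ 2 μ) x ^ 2 ∂μ = ∫ x, (F a x - g x) ^ 2 ∂μ := by
        refine integral_congr_ae ?_
        filter_upwards [(h a).coeFn_toLp, Lp.coeFn_sub ((h a).toLp (F a)) g] with x h1 h2
        rw [h2, Pi.sub_apply, h1]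
      rw [this]
    rw [he]
    exact measurableSet_lt hm measurable_const
  refine measurable_of_isOpen fun U hU => ?_
  have hr : ∀ g ∈ U, ∃ r > 0, Metric.ball g r ⊆ U := Metric.isOpen_iff.1 hU
  choose! r hr0 hrU using hr
  obtain ⟨T, hTU, hTc, hT⟩ := TopologicalSpace.isOpen_biUnion_countable U
    (fun g => Metric.ball g (r g)) fun _ _ => Metric.isOpen_ball
  have hU' : U = ⋃ g ∈ T, Metric.ball g (r g) := by
    rw [hT]
    refine subset_antisymm (fun g hg => ?_) (iUnion₂_subset hrU)
    exact mem_iUnion₂.2 ⟨g, hg, Metric.mem_ball_self (hr0 g hg)⟩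
  rw [hU', preimage_iUnion₂]
  exact MeasurableSet.biUnion hTc fun g hg => hball g (r g) (hr0 g (hTU hg))

end BddMeasurable

/-! ### Integral operators with bounded kernels: boundedness, symmetry, compactness -/

section KernelOperator

variable {K K' : ℝ → ℝ → ℝ}

/-- Turns the almost everywhere identities of an eigensystem into equations for the operator, to
which the spectral results apply. -/
theorem IsIntegralImage.unique {μ : Measure ℝ} {f g g' : Lp ℝ 2 μ} (h : IsIntegralImage μ K f g)
    (h' : IsIntegralImage μ K f g') : g = g' := by
  refine Lp.ext ?_
  filter_upwards [h, h'] with x h1 h2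
  rw [h1, h2]

variable {μ : Measure ℝ} [IsFiniteMeasure μ]

theorem BddMeasurable.section_right {α : Type*} [MeasurableSpace α] {F : α → ℝ → ℝ}
    (hF : BddMeasurable fun z : α × ℝ => F z.1 z.2) (a : α) : BddMeasurable (F a) :=
  hF.comp (φ := fun y => (a, y)) measurable_prodMk_left

theorem sq_integral_mul_le {k : ℝ → ℝ} (hk : BddMeasurable k) (f : Lp ℝ 2 μ) :
    (∫ y, k y * f y ∂μ) ^ 2 ≤ (∫ y, k y ^ 2 ∂μ) * ‖f‖ ^ 2 := by
  rw [← inner_toLp_left (hk.memLp μ 2), ← norm_toLp_sq (hk.memLp μ 2), ← mul_pow]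
  exact sq_le_sq' (by linarith [neg_le_of_abs_le (abs_real_inner_le_norm
    ((hk.memLp μ 2).toLp k) f)]) (real_inner_le_norm _ _)

theorem integrable_bdd_mul_Lp {k : ℝ → ℝ} (hk : BddMeasurable k) (f : Lp ℝ 2 μ) :
    Integrable (fun y => k y * f y) μ := by
  obtain ⟨hm, B, hB⟩ := hk
  exact (integrable_Lp f).bdd_mul hm.aestronglyMeasurable (ae_of_all _ hB)

theorem IsIntegralImage.sub (hK : BddMeasurable fun z : ℝ × ℝ => K z.1 z.2)
    (hK' : BddMeasurable fun z : ℝ × ℝ => K' z.1 z.2) {f g g' : Lp ℝ 2 μ}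
    (h : IsIntegralImage μ K f g) (h' : IsIntegralImage μ K' f g') :
    IsIntegralImage μ (fun x y => K x y - K' x y) f (g - g') := by
  unfold IsIntegralImage at *
  filter_upwards [h, h', Lp.coeFn_sub g g'] with x h1 h2 h3
  rw [h3, Pi.sub_apply, h1, h2, ← integral_sub (integrable_bdd_mul_Lp (hK.section_right x) f)
    (integrable_bdd_mul_Lp (hK'.section_right x) f)]
  simp_rw [sub_mul]

/-- The Hilbert–Schmidt bound. -/
theorem IsIntegralImage.norm_le (hK : BddMeasurable fun z : ℝ × ℝ => K z.1 z.2)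
    {f g : Lp ℝ 2 μ} (h : IsIntegralImage μ K f g) :
    ‖g‖ ≤ √(∫ x, ∫ y, K x y ^ 2 ∂μ ∂μ) * ‖f‖ := by
  refine abs_le_of_sq_le_sq' ?_ (by positivity) |>.2
  rw [mul_pow, Real.sq_sqrt (integral_nonneg fun x => integral_nonneg fun y => sq_nonneg _),
    norm_Lp_sq g, ← integral_mul_const]
  refine integral_mono_ae (integrable_sq_Lp g) ((BddMeasurable.integral_right
    (F := fun x y => K x y ^ 2) hK.sq μ).integrable μ |>.mul_const _) ?_
  filter_upwards [h] with x hx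
  rw [hx]
  exact sq_integral_mul_le (hK.section_right x) f

theorem exists_kernelOperator (hK : BddMeasurable fun z : ℝ × ℝ => K z.1 z.2) :
    ∃ T : Lp ℝ 2 μ →L[ℝ] Lp ℝ 2 μ, ∀ f, IsIntegralImage μ K f (T f) := by
  have hmem : ∀ f : Lp ℝ 2 μ, MemLp (fun x => ∫ y, K x y * f y ∂μ) 2 μ := by
    intro f
    have hm : StronglyMeasurable fun x => ∫ y, K x y * f y ∂μ :=
      StronglyMeasurable.integral_prod_right' (f := fun z : ℝ × ℝ => K z.1 z.2 * f z.2)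
        (hK.1.mul ((Lp.stronglyMeasurable f).measurable.comp measurable_snd)).stronglyMeasurable
    refine (memLp_two_iff_integrable_sq hm.aestronglyMeasurable).2 ?_
    refine (((BddMeasurable.integral_right (F := fun x y => K x y ^ 2) hK.sq μ).integrable
      μ).mul_const (‖f‖ ^ 2)).mono'
      (hm.pow 2).aestronglyMeasurable (ae_of_all _ fun x => ?_)
    rw [Real.norm_of_nonneg (sq_nonneg _)]
    exact sq_integral_mul_le (hK.section_right x) f
  have himg : ∀ f, IsIntegralImage μ K f ((hmem f).toLp _) := fun f => (hmem f).coeFn_toLp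
  let T₀ : Lp ℝ 2 μ →ₗ[ℝ] Lp ℝ 2 μ :=
    { toFun := fun f => (hmem f).toLp _
      map_add' := fun f g => by
        refine (himg (f + g)).unique ?_
        filter_upwards [himg f, himg g, Lp.coeFn_add ((hmem f).toLp _) ((hmem g).toLp _)]
          with x h1 h2 h3
        rw [h3, Pi.add_apply, h1, h2, ← integral_add
          (integrable_bdd_mul_Lp (hK.section_right x) f)
          (integrable_bdd_mul_Lp (hK.section_right x) g)]
        refine integral_congr_ae ?_
        filter_upwards [Lp.coeFn_add f g] with y hy
        rw [hy, Pi.add_apply, mul_add]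
      map_smul' := fun c f => by
        refine (himg (c • f)).unique ?_
        filter_upwards [himg f, Lp.coeFn_smul c ((hmem f).toLp _)] with x h1 h3
        rw [RingHom.id_apply, h3, Pi.smul_apply, h1, smul_eq_mul, ← integral_const_mul]
        refine integral_congr_ae ?_
        filter_upwards [Lp.coeFn_smul c f] with y hy
        rw [hy, Pi.smul_apply, smul_eq_mul]
        ring }
  exact ⟨T₀.mkContinuous _ fun f => (himg f).norm_le hK, himg⟩

/-- Fubini; the integrand is dominated by a constant times `|g x * f y|`, which is integrable for
the product measure since `μ` is finite. -/
theorem inner_kernelOperator_comm (hK : BddMeasurable fun z : ℝ × ℝ => K z.1 z.2)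
    (hsymm : ∀ x y, K x y = K y x) {T : Lp ℝ 2 μ →L[ℝ] Lp ℝ 2 μ}
    (hT : ∀ f, IsIntegralImage μ K f (T f)) (f g : Lp ℝ 2 μ) : ⟪T f, g⟫ = ⟪f, T g⟫ := by
  have hl : ⟪T f, g⟫ = ∫ x, ∫ y, K x y * (g x * f y) ∂μ ∂μ := by
    rw [L2.inner_def]
    refine integral_congr_ae ?_
    filter_upwards [hT f] with x hx
    rw [hx, real_inner_comm]
    simp only [RCLike.inner_apply, conj_trivial]
    rw [← integral_mul_const]
    exact integral_congr_ae (ae_of_all _ fun y => by ring)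
  have hr : ⟪f, T g⟫ = ∫ y, ∫ x, K x y * (g x * f y) ∂μ ∂μ := by
    rw [L2.inner_def]
    refine integral_congr_ae ?_
    filter_upwards [hT g] with x hx
    rw [hx]
    simp only [RCLike.inner_apply, conj_trivial]
    rw [← integral_mul_const]
    exact integral_congr_ae (ae_of_all _ fun y => by simp only [hsymm x y]; ring)
  rw [hl, hr]
  refine integral_integral_swap ?_
  obtain ⟨hm, B, hB⟩ := hK
  exact ((integrable_Lp g).mul_prod (integrable_Lp f)).bdd_mul hm.aestronglyMeasurable
    (ae_of_all _ hB)

/-- View the kernel as the bounded map `k : x ↦ K x` into `L²(μ)`, so that `T f x = ⟪k x, f⟫`.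
Replacing `k` by simple functions gives finite rank operators, and these converge to `T` in norm
because the error is at most the `L²` norm of `x ↦ ‖k x - s n x‖`, which vanishes by dominated
convergence. -/
theorem isCompactOperator_kernelOperator (hK : BddMeasurable fun z : ℝ × ℝ => K z.1 z.2)
    {T : Lp ℝ 2 μ →L[ℝ] Lp ℝ 2 μ} (hT : ∀ f, IsIntegralImage μ K f (T f)) :
    IsCompactOperator T := by
  have hmem : ∀ x, MemLp (K x) 2 μ := fun x => (hK.section_right x).memLp μ 2
  have hk := stronglyMeasurable_toLp hK hmem
  set k : ℝ → Lp ℝ 2 μ := fun x => (hmem x).toLp (K x) with hkdef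
  obtain ⟨c, hc⟩ : ∃ c, ∀ x, ‖k x‖ ≤ c := by
    obtain ⟨-, B, hB⟩ := BddMeasurable.integral_right (F := fun x y => K x y ^ 2) hK.sq μ
    refine ⟨√B, fun x => Real.le_sqrt_of_sq_le ?_⟩
    rw [norm_toLp_sq]
    exact (le_abs_self _).trans (hB x)
  have hc0 : 0 ≤ c := (norm_nonneg _).trans (hc 0)
  let s : ℕ → SimpleFunc ℝ (Lp ℝ 2 μ) := hk.approxBounded c
  have hs : ∀ x, Tendsto (fun n => s n x) atTop (𝓝 (k x)) := fun x =>
    hk.tendsto_approxBounded_of_norm_le (hc x)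
  have hsc : ∀ n x, ‖s n x‖ ≤ c := fun n x => hk.norm_approxBounded_le hc0 n x
  -- The finite rank operator `f ↦ (x ↦ ⟪s n x, f⟫)`, written as a sum over the values of `s n`.
  let A : ℕ → Lp ℝ 2 μ →L[ℝ] Lp ℝ 2 μ := fun n => ∑ h ∈ (s n).range,
    (innerSL ℝ h).smulRight
      (indicatorConstLp 2 ((s n).measurableSet_fiber h) (measure_ne_top μ _) (1 : ℝ))
  have hA : ∀ n f, ∀ᵐ x ∂μ, A n f x = ⟪s n x, f⟫ := by
    intro n f
    have h1 : A n f = ∑ h ∈ (s n).range, ⟪h, f⟫ •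
        indicatorConstLp 2 ((s n).measurableSet_fiber h) (measure_ne_top μ _) (1 : ℝ) := by
      simp [A]
    have h2 : ∀ᵐ x ∂μ, ∀ h ∈ (s n).range, (⟪h, f⟫ •
        indicatorConstLp 2 ((s n).measurableSet_fiber h) (measure_ne_top μ _) (1 : ℝ) :
          Lp ℝ 2 μ) x = ⟪h, f⟫ * ((s n) ⁻¹' {h}).indicator (fun _ => 1) x := by
      rw [Finset.eventually_all]
      intro h _
      filter_upwards [Lp.coeFn_smul ⟪h, f⟫ (indicatorConstLp 2 ((s n).measurableSet_fiber h)
        (measure_ne_top μ _) (1 : ℝ)), indicatorConstLp_coeFn (p := 2)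
        (hs := (s n).measurableSet_fiber h) (hμs := measure_ne_top μ _) (c := (1 : ℝ))]
        with x h3 h4
      rw [h3, Pi.smul_apply, h4, smul_eq_mul]
    filter_upwards [Lp.coeFn_finsetSum (s n).range fun h => (⟪h, f⟫ •
        indicatorConstLp 2 ((s n).measurableSet_fiber h) (measure_ne_top μ _) (1 : ℝ) :
          Lp ℝ 2 μ), h2] with x h3 h4
    rw [h1, h3, Finset.sum_apply, Finset.sum_congr rfl h4, Finset.sum_eq_single (s n x)]
    · simp
    · intro h _ hne
      simp [Ne.symm hne]
    · intro h
      exact absurd (SimpleFunc.mem_range_self _ _) h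
  have hlim : Tendsto A atTop (𝓝 T) := by
    have hI : Tendsto (fun n => ∫ x, ‖k x - s n x‖ ^ 2 ∂μ) atTop (𝓝 0) := by
      have : Tendsto (fun n => ∫ x, ‖k x - s n x‖ ^ 2 ∂μ) atTop (𝓝 (∫ x, (0 : ℝ) ∂μ)) := by
        refine tendsto_integral_of_dominated_convergence (fun _ => (2 * c) ^ 2)
          (fun n => ((hk.sub (s n).stronglyMeasurable).norm.pow 2).aestronglyMeasurable)
          (integrable_const _) (fun n => ae_of_all _ fun x => ?_) (ae_of_all _ fun x => ?_)
        · rw [Real.norm_of_nonneg (sq_nonneg _)]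
          have := norm_sub_le (k x) (s n x)
          gcongr
          linarith [hc x, hsc n x]
        · have h0 : Tendsto (fun n => ‖k x - s n x‖ ^ 2) atTop (𝓝 (‖k x - k x‖ ^ 2)) :=
            ((tendsto_const_nhds.sub (hs x)).norm).pow 2
          simpa using h0
      simpa using this
    rw [tendsto_iff_norm_sub_tendsto_zero]
    have hsq : Tendsto (fun n => √(∫ x, ‖k x - s n x‖ ^ 2 ∂μ)) atTop (𝓝 0) := by
      simpa using hI.sqrt
    refine squeeze_zero (fun n => norm_nonneg _) (fun n => ?_) hsq
    refine ContinuousLinearMap.opNorm_le_bound _ (Real.sqrt_nonneg _) fun f => ?_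
    refine abs_le_of_sq_le_sq' ?_ (by positivity) |>.2
    rw [mul_pow, Real.sq_sqrt (integral_nonneg fun x => sq_nonneg _), norm_Lp_sq,
      ← integral_mul_const]
    refine integral_mono_ae (integrable_sq_Lp _) ?_ ?_
    · refine Integrable.mul_const ?_ _
      refine Integrable.of_bound
        ((hk.sub (s n).stronglyMeasurable).norm.pow 2).aestronglyMeasurable ((2 * c) ^ 2)
        (ae_of_all _ fun x => ?_)
      rw [Real.norm_of_nonneg (sq_nonneg _)]
      have := norm_sub_le (k x) (s n x)
      gcongr
      linarith [hc x, hsc n x]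
    · filter_upwards [hA n f, hT f, Lp.coeFn_sub (A n f) (T f)] with x h1 h2 h3
      rw [sub_apply, h3, Pi.sub_apply, h1, h2, ← inner_toLp_left (hmem x),
        ← inner_sub_left, ← mul_pow, ← norm_sub_rev (s n x)]
      exact sq_le_sq' (by linarith [neg_le_of_abs_le (abs_real_inner_le_norm
        (s n x - k x) f)]) (real_inner_le_norm _ _)
  refine isCompactOperator_of_tendsto hlim (Eventually.of_forall fun n => ?_)
  have hone : ∀ h g : Lp ℝ 2 μ, IsCompactOperator ((innerSL ℝ h).smulRight g) := by
    intro h g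
    have h1 : IsCompactOperator (innerSL ℝ h : Lp ℝ 2 μ →L[ℝ] ℝ) :=
      isCompactOperator_of_locallyCompactSpace_dom _
    exact h1.clm_comp (ContinuousLinearMap.toSpanSingleton ℝ g)
  have : A n ∈ compactOperator (RingHom.id ℝ) (Lp ℝ 2 μ) (Lp ℝ 2 μ) :=
    Submodule.sum_mem _ fun h _ => hone h _
  exact this

end KernelOperator

/-! ### Covariance inequality and mean square errors under `ψ`-mixing -/

section Mixing

variable {Ω : Type*} {𝓐 𝓑 : MeasurableSpace Ω} [mΩ : MeasurableSpace Ω] {P : Measure Ω}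
  {𝓖 : ℕ → MeasurableSpace Ω}

/-- Write `Ψ = Ψ^{1/2} Ψ^{1/2}`; one factor is at most the whole weighted sum, the other is summed.
-/
theorem tsum_psiMixingCoeff_lt_top
    (h : ∑' k : ℕ, ((k + 1 : ℕ) : ℝ≥0∞) * psiMixingCoeff P 𝓖 (k + 1) ^ (1 / 2 : ℝ) < ∞) :
    ∑' k : ℕ, psiMixingCoeff P 𝓖 (k + 1) < ∞ := by
  set T := ∑' k : ℕ, ((k + 1 : ℕ) : ℝ≥0∞) * psiMixingCoeff P 𝓖 (k + 1) ^ (1 / 2 : ℝ)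
  have h1 : ∀ k : ℕ, psiMixingCoeff P 𝓖 (k + 1) ^ (1 / 2 : ℝ)
      ≤ ((k + 1 : ℕ) : ℝ≥0∞) * psiMixingCoeff P 𝓖 (k + 1) ^ (1 / 2 : ℝ) := fun k =>
    le_mul_of_one_le_left zero_le (by exact_mod_cast Nat.succ_pos k)
  have h2 : ∀ k : ℕ, psiMixingCoeff P 𝓖 (k + 1)
      ≤ T * (((k + 1 : ℕ) : ℝ≥0∞) * psiMixingCoeff P 𝓖 (k + 1) ^ (1 / 2 : ℝ)) := fun k => by
    have h3 : psiMixingCoeff P 𝓖 (k + 1) = psiMixingCoeff P 𝓖 (k + 1) ^ (1 / 2 : ℝ)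
        * psiMixingCoeff P 𝓖 (k + 1) ^ (1 / 2 : ℝ) := by
      rw [← ENNReal.rpow_add_of_nonneg _ _ (by norm_num) (by norm_num)]
      norm_num
    calc psiMixingCoeff P 𝓖 (k + 1) = _ := h3
      _ ≤ _ := mul_le_mul' ((h1 k).trans (ENNReal.le_tsum k)) (h1 k)
  calc ∑' k : ℕ, psiMixingCoeff P 𝓖 (k + 1) ≤ ∑' k : ℕ, T * _ := ENNReal.tsum_le_tsum h2
    _ = T * T := ENNReal.tsum_mul_left
    _ < ∞ := ENNReal.mul_lt_top h h

/-- With truncated subtraction the argument of `a` is `|t - s|`, which takes each value at most once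
on either side of `s`. -/
theorem sum_Icc_comp_sub_le {a : ℕ → ℝ} (ha : ∀ i, 0 ≤ a i) (hs : Summable a) (N s : ℕ) :
    ∑ t ∈ Finset.Icc 1 N, a ((t - s) + (s - t)) ≤ 2 * ∑' i, a i := by
  have h1 : ∀ (S : Finset ℕ) (φ : ℕ → ℕ), Set.InjOn φ S → ∑ t ∈ S, a (φ t) ≤ ∑' i, a i := by
    intro S φ hφ
    rw [← Finset.sum_image (f := a) hφ]
    exact hs.sum_le_tsum _ fun i _ => ha i
  rw [← Finset.sum_filter_add_sum_filter_not _ (fun t => s ≤ t), two_mul]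
  refine add_le_add (h1 _ _ fun x hx y hy h => ?_) (h1 _ _ fun x hx y hy h => ?_) <;>
  · simp only [Finset.coe_filter, Set.mem_ofPred_eq] at hx hy
    omega

variable [IsProbabilityMeasure P]

/-- The product form, unlike the quotient, also makes sense for null sets, so it can be read as a
domination of measures. -/
theorem measure_inter_le_psiDependence {A B : Set Ω}
    (hA : MeasurableSet[𝓐] A) (hB : MeasurableSet[𝓑] B) :
    P (A ∩ B) ≤ (1 + psiDependence P 𝓐 𝓑) * P A * P B := by
  by_cases hA0 : P A = 0
  · rw [measure_mono_null inter_subset_left hA0]; exact zero_le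
  by_cases hB0 : P B = 0
  · rw [measure_mono_null inter_subset_right hB0]; exact zero_le
  set Ψ := psiDependence P 𝓐 𝓑
  have h : ENNReal.ofReal |P.real (A ∩ B) / (P.real A * P.real B) - 1| ≤ Ψ :=
    le_iSup_of_le A <| le_iSup_of_le hA <| le_iSup_of_le hA0 <| le_iSup_of_le B <|
      le_iSup_of_le hB <| le_iSup_of_le hB0 le_rfl
  have ha : 0 < P.real A := ENNReal.toReal_pos hA0 (measure_ne_top _ _)
  have hb : 0 < P.real B := ENNReal.toReal_pos hB0 (measure_ne_top _ _)
  set d := |P.real (A ∩ B) / (P.real A * P.real B) - 1| with hd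
  have h1 : P.real (A ∩ B) ≤ (1 + d) * P.real A * P.real B := by
    have h2 : P.real (A ∩ B) / (P.real A * P.real B) ≤ 1 + d := by
      linarith [le_abs_self (P.real (A ∩ B) / (P.real A * P.real B) - 1)]
    rw [div_le_iff₀ (by positivity)] at h2
    linarith
  calc P (A ∩ B) = ENNReal.ofReal (P.real (A ∩ B)) := by rw [ofReal_measureReal]
    _ ≤ ENNReal.ofReal ((1 + d) * P.real A * P.real B) := ENNReal.ofReal_le_ofReal h1
    _ = (1 + ENNReal.ofReal d) * P A * P B := by
        rw [ENNReal.ofReal_mul (by positivity), ENNReal.ofReal_mul (by positivity),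
          ENNReal.ofReal_add zero_le_one (abs_nonneg _), ENNReal.ofReal_one, ofReal_measureReal,
          ofReal_measureReal]
    _ ≤ (1 + Ψ) * P A * P B := by gcongr

/-- Two dominations of measures replace an approximation by simple functions: for fixed `A`, the
measure `B ↦ P (A ∩ B)` is at most a multiple of `P` on `𝓑`, and integrating `g` shows that `A ↦ ∫_A
g` is at most a multiple of `P` on `𝓐`. -/
theorem lintegral_mul_le_psiDependence (h𝓐 : 𝓐 ≤ mΩ) (h𝓑 : 𝓑 ≤ mΩ)
    {f g : Ω → ℝ≥0∞} (hf : Measurable[𝓐] f) (hg : Measurable[𝓑] g) :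
    ∫⁻ ω, f ω * g ω ∂P
      ≤ (1 + psiDependence P 𝓐 𝓑) * (∫⁻ ω, f ω ∂P) * ∫⁻ ω, g ω ∂P := by
  set Ψ := psiDependence P 𝓐 𝓑
  have h1 : ∀ A, MeasurableSet[𝓐] A → ∫⁻ ω in A, g ω ∂P ≤ (1 + Ψ) * P A * ∫⁻ ω, g ω ∂P := by
    intro A hA
    have hle : (P.restrict A).trim h𝓑 ≤ ((1 + Ψ) * P A) • P.trim h𝓑 := by
      refine Measure.le_iff.2 fun B hB => ?_
      rw [trim_measurableSet_eq h𝓑 hB, Measure.restrict_apply (h𝓑 _ hB), Measure.smul_apply,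
        trim_measurableSet_eq h𝓑 hB, smul_eq_mul, inter_comm]
      exact measure_inter_le_psiDependence hA hB
    rw [← lintegral_trim h𝓑 hg, ← lintegral_trim h𝓑 hg]
    refine (lintegral_mono' hle le_rfl).trans ?_
    rw [lintegral_smul_measure, smul_eq_mul]
  have hg' : Measurable g := hg.mono h𝓑 le_rfl
  have hf' : Measurable f := hf.mono h𝓐 le_rfl
  have hle : (P.withDensity g).trim h𝓐 ≤ ((1 + Ψ) * ∫⁻ ω, g ω ∂P) • P.trim h𝓐 := by
    refine Measure.le_iff.2 fun A hA => ?_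
    rw [trim_measurableSet_eq h𝓐 hA, withDensity_apply _ (h𝓐 _ hA), Measure.smul_apply,
      trim_measurableSet_eq h𝓐 hA, smul_eq_mul, mul_right_comm]
    exact h1 A hA
  calc ∫⁻ ω, f ω * g ω ∂P = ∫⁻ ω, f ω ∂(P.withDensity g) := by
        rw [lintegral_withDensity_eq_lintegral_mul _ hg' hf']
        simp_rw [Pi.mul_apply, mul_comm]
    _ = ∫⁻ ω, f ω ∂((P.withDensity g).trim h𝓐) := (lintegral_trim h𝓐 hf).symm
    _ ≤ ∫⁻ ω, f ω ∂(((1 + Ψ) * ∫⁻ ω, g ω ∂P) • P.trim h𝓐) := lintegral_mono' hle le_rfl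
    _ = _ := by
        rw [lintegral_smul_measure, smul_eq_mul, lintegral_trim h𝓐 hf, mul_right_comm]

/-- The covariance inequality for `ψ`-mixing, for variables with values in `[0, 1]`. -/
theorem integral_mul_le_add_psiDependence (h𝓐 : 𝓐 ≤ mΩ) (h𝓑 : 𝓑 ≤ mΩ)
    {f g : Ω → ℝ} (hf : Measurable[𝓐] f) (hg : Measurable[𝓑] g) (hf0 : ∀ ω, 0 ≤ f ω)
    (hf1 : ∀ ω, f ω ≤ 1) (hg0 : ∀ ω, 0 ≤ g ω) (hg1 : ∀ ω, g ω ≤ 1)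
    (hΨ : psiDependence P 𝓐 𝓑 ≠ ∞) :
    ∫ ω, f ω * g ω ∂P ≤ (∫ ω, f ω ∂P) * (∫ ω, g ω ∂P) + (psiDependence P 𝓐 𝓑).toReal := by
  set Ψ := psiDependence P 𝓐 𝓑
  have hf' : BddMeasurable f :=
    ⟨hf.mono h𝓐 le_rfl, 1, fun ω => by rw [abs_of_nonneg (hf0 ω)]; exact hf1 ω⟩
  have hg' : BddMeasurable g :=
    ⟨hg.mono h𝓑 le_rfl, 1, fun ω => by rw [abs_of_nonneg (hg0 ω)]; exact hg1 ω⟩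
  have h := lintegral_mul_le_psiDependence (P := P) h𝓐 h𝓑 (f := fun ω => ENNReal.ofReal (f ω))
    (g := fun ω => ENNReal.ofReal (g ω)) hf.ennreal_ofReal hg.ennreal_ofReal
  have he : ∀ {u : Ω → ℝ}, BddMeasurable u → (∀ ω, 0 ≤ u ω) →
      ∫⁻ ω, ENNReal.ofReal (u ω) ∂P = ENNReal.ofReal (∫ ω, u ω ∂P) := fun hu h0 =>
    (ofReal_integral_eq_lintegral_ofReal (hu.integrable P) (ae_of_all _ h0)).symm
  simp_rw [← ENNReal.ofReal_mul (hf0 _)] at h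
  rw [he (hf'.mul hg') fun ω => mul_nonneg (hf0 ω) (hg0 ω), he hf' hf0, he hg' hg0] at h
  have hi : ∀ {u : Ω → ℝ}, BddMeasurable u → (∀ ω, u ω ≤ 1) → ∫ ω, u ω ∂P ≤ 1 := fun hu h1 => by
    simpa using integral_mono (hu.integrable P) (integrable_const (1 : ℝ)) h1
  have hIf := hi hf' hf1
  have hIg := hi hg' hg1
  have hf00 : 0 ≤ ∫ ω, f ω ∂P := integral_nonneg hf0
  have hg00 : 0 ≤ ∫ ω, g ω ∂P := integral_nonneg hg0
  have hΨe : 1 + Ψ = ENNReal.ofReal (1 + Ψ.toReal) := by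
    rw [ENNReal.ofReal_add zero_le_one ENNReal.toReal_nonneg, ENNReal.ofReal_one,
      ENNReal.ofReal_toReal hΨ]
  have hΨ0 : 0 ≤ Ψ.toReal := ENNReal.toReal_nonneg
  rw [hΨe, ← ENNReal.ofReal_mul (by positivity), ← ENNReal.ofReal_mul (by positivity),
    ENNReal.ofReal_le_ofReal_iff (by positivity)] at h
  -- Both means are at most `1`, so the relative error `Ψ` becomes an absolute one.
  have := mul_le_one₀ hIf hg00 hIg
  nlinarith [mul_le_mul_of_nonneg_left this hΨ0]

/-- Mean square error of averages of a `ψ`-mixing sequence with values in `[0, 1]` and constant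
mean, whose `t`-th term depends on the σ-fields at the times `t, …, t + p`. -/
theorem exists_integral_sq_avg_sub_le (h𝓖 : ∀ t, 𝓖 t ≤ mΩ) (p : ℕ)
    (h : ∑' k : ℕ, ((k + 1 : ℕ) : ℝ≥0∞) * psiMixingCoeff P 𝓖 (k + 1) ^ (1 / 2 : ℝ) < ∞) :
    ∃ B : ℝ, 0 ≤ B ∧ ∀ (Y : ℕ → Ω → ℝ) (c : ℝ),
      (∀ t, 1 ≤ t → Measurable[⨆ s ∈ Set.Icc t (t + p), 𝓖 s] (Y t)) →
      (∀ t ω, 0 ≤ Y t ω) → (∀ t ω, Y t ω ≤ 1) → (∀ t, 1 ≤ t → ∫ ω, Y t ω ∂P = c) →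
      ∀ N : ℕ, 1 ≤ N →
        ∫ ω, ((N : ℝ)⁻¹ * ∑ t ∈ Finset.Icc 1 N, Y t ω - c) ^ 2 ∂P ≤ B / N := by
  have hfin := tsum_psiMixingCoeff_lt_top h
  -- Majorant of the covariance at lag `i`: up to lag `p` the windows may overlap and only the
  -- trivial bound is used; beyond it they are `i - p` apart. Upper bounds of covariances suffice to
  -- bound the variance of the average.
  let a : ℕ → ℝ := fun i => if i ≤ p then 1 else (psiMixingCoeff P 𝓖 (i - p)).toReal
  have ha0 : ∀ i, 0 ≤ a i := fun i => by
    simp only [a]; split_ifs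
    · exact zero_le_one
    · exact ENNReal.toReal_nonneg
  have hsum : Summable a := by
    rw [← summable_nat_add_iff (p + 1)]
    have : (fun i => a (i + (p + 1))) = fun i => (psiMixingCoeff P 𝓖 (i + 1)).toReal := by
      ext i
      simp only [a]
      rw [if_neg (by omega)]
      congr 2
      omega
    rw [this]
    exact ENNReal.summable_toReal hfin.ne
  refine ⟨2 * ∑' i, a i, mul_nonneg zero_le_two (tsum_nonneg ha0),
    fun Y c hY hY0 hY1 hc N hN => ?_⟩
  have hmeas : ∀ t, 1 ≤ t → BddMeasurable (Y t) := fun t ht =>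
    ⟨(hY t ht).mono (iSup₂_le fun s _ => h𝓖 s) le_rfl, 1, fun ω => by
      rw [abs_of_nonneg (hY0 t ω)]; exact hY1 t ω⟩
  have hcov_eq : ∀ s t, 1 ≤ s → 1 ≤ t →
      ∫ ω, (Y s ω - c) * (Y t ω - c) ∂P = ∫ ω, Y s ω * Y t ω ∂P - c * c := by
    intro s t hs ht
    have he : ∀ ω, (Y s ω - c) * (Y t ω - c)
        = Y s ω * Y t ω - (c * Y s ω + (c * Y t ω - c * c)) := fun ω => by ring
    simp_rw [he]
    have is := (BddMeasurable.const c).mul (hmeas s hs)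
    have it := (BddMeasurable.const c).mul (hmeas t ht)
    have ic := BddMeasurable.const (α := Ω) (c * c)
    rw [integral_sub (((hmeas s hs).mul (hmeas t ht)).integrable P)
      ((is.add (it.sub ic)).integrable P),
      integral_add (is.integrable P) ((it.sub ic).integrable P),
      integral_sub (it.integrable P) (ic.integrable P), integral_const_mul, integral_const_mul,
      hc s hs, hc t ht]
    simp
  have hcov' : ∀ s t, 1 ≤ s → s ≤ t → ∫ ω, (Y s ω - c) * (Y t ω - c) ∂P ≤ a (t - s) := by
    intro s t hs hst
    have ht := hs.trans hst
    rw [hcov_eq s t hs ht]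
    have hcc : 0 ≤ c * c := mul_self_nonneg c
    simp only [a]
    split_ifs with hp
    · have h1 : ∫ ω, Y s ω * Y t ω ∂P ≤ ∫ _, (1 : ℝ) ∂P :=
        integral_mono (((hmeas s hs).mul (hmeas t ht)).integrable P) (integrable_const _)
          fun ω => mul_le_one₀ (hY1 s ω) (hY0 t ω) (hY1 t ω)
      simp only [integral_const, probReal_univ, smul_eq_mul, mul_one] at h1
      linarith
    · set k := t - s - p with hk
      have hk1 : 1 ≤ k := by omega
      -- `Y s` depends on the cycles up to `s + p`, and `Y t` on those from `t = s + p + k` on.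
      have hpsi : psiDependence P (⨆ r ∈ Set.Icc 1 (s + p), 𝓖 r) (⨆ r ∈ Set.Ici (s + p + k), 𝓖 r)
          ≤ psiMixingCoeff P 𝓖 k :=
        le_iSup₂ (f := fun m (_ : 1 ≤ m) =>
          psiDependence P (⨆ r ∈ Set.Icc 1 m, 𝓖 r) (⨆ r ∈ Set.Ici (m + k), 𝓖 r)) (s + p) (by omega)
      have hkfin : psiMixingCoeff P 𝓖 k ≠ ∞ := by
        have := (ENNReal.le_tsum (f := fun k => psiMixingCoeff P 𝓖 (k + 1)) (k - 1)).trans_lt hfin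
        simp only [Nat.sub_add_cancel hk1] at this
        exact this.ne
      have hm := integral_mul_le_add_psiDependence (P := P)
        (𝓐 := ⨆ r ∈ Set.Icc 1 (s + p), 𝓖 r) (𝓑 := ⨆ r ∈ Set.Ici (s + p + k), 𝓖 r)
        (iSup₂_le fun r _ => h𝓖 r) (iSup₂_le fun r _ => h𝓖 r) (f := Y s) (g := Y t)
        ((hY s hs).mono (biSup_mono fun r hr => ⟨hs.trans hr.1, hr.2⟩) le_rfl)
        ((hY t ht).mono (biSup_mono fun r hr => by
          have := hr.1
          simp only [Set.mem_Ici]; omega) le_rfl)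
        (hY0 s) (hY1 s) (hY0 t) (hY1 t) (hpsi.trans_lt hkfin.lt_top).ne
      rw [hc s hs, hc t ht] at hm
      have := ENNReal.toReal_mono hkfin hpsi
      linarith
  have hcov : ∀ s ∈ Finset.Icc 1 N, ∀ t ∈ Finset.Icc 1 N,
      ∫ ω, (Y s ω - c) * (Y t ω - c) ∂P ≤ a ((t - s) + (s - t)) := by
    intro s hs t ht
    rcases le_total s t with h | h
    · rw [Nat.sub_eq_zero_of_le h, add_zero]
      exact hcov' s t (Finset.mem_Icc.1 hs).1 h
    · rw [Nat.sub_eq_zero_of_le h, zero_add]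
      simp_rw [mul_comm (Y s _ - c)]
      exact hcov' t s (Finset.mem_Icc.1 ht).1 h
  have hN0 : (0 : ℝ) < N := by exact_mod_cast hN
  have hexp : ∀ ω, ((N : ℝ)⁻¹ * ∑ t ∈ Finset.Icc 1 N, Y t ω - c) ^ 2
      = ((N : ℝ)⁻¹) ^ 2 *
        ∑ s ∈ Finset.Icc 1 N, ∑ t ∈ Finset.Icc 1 N, (Y s ω - c) * (Y t ω - c) := by
    intro ω
    rw [← Finset.sum_mul_sum, ← sq, ← mul_pow, Finset.sum_sub_distrib, Finset.sum_const,
      Nat.card_Icc, Nat.add_sub_cancel, nsmul_eq_mul, mul_sub, inv_mul_cancel_left₀ hN0.ne']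
  have hint : ∀ s ∈ Finset.Icc 1 N, ∀ t ∈ Finset.Icc 1 N,
      Integrable (fun ω => (Y s ω - c) * (Y t ω - c)) P := fun s hs t ht =>
    (((hmeas s (Finset.mem_Icc.1 hs).1).sub (BddMeasurable.const c)).mul
      ((hmeas t (Finset.mem_Icc.1 ht).1).sub (BddMeasurable.const c))).integrable P
  simp_rw [hexp]
  rw [integral_const_mul, integral_finsetSum _ fun s hs => integrable_finsetSum _ (hint s hs)]
  have hle : ∑ s ∈ Finset.Icc 1 N, ∫ ω, ∑ t ∈ Finset.Icc 1 N, (Y s ω - c) * (Y t ω - c) ∂P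
      ≤ N * (2 * ∑' i, a i) := by
    calc _ ≤ ∑ s ∈ Finset.Icc 1 N, 2 * ∑' i, a i := by
          refine Finset.sum_le_sum fun s hs => ?_
          rw [integral_finsetSum _ (hint s hs)]
          exact (Finset.sum_le_sum (hcov s hs)).trans (sum_Icc_comp_sub_le ha0 hsum N s)
      _ = _ := by simp
  calc _ ≤ ((N : ℝ)⁻¹) ^ 2 * (N * (2 * ∑' i, a i)) := by gcongr
    _ = _ := by field_simp

end Mixing

/-! ### Measurability and moments of latent and empirical distribution functions -/

section Moments

/-- Joint measurability comes from viewing `(ν, x) ↦ ν` as a Markov kernel and evaluating it on the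
sections of `{w | w.2 ≤ w.1.2}`. -/
theorem measurable_distFun :
    Measurable fun z : ProbabilityMeasure ℝ × ℝ => distFun z.1 z.2 := by
  let κ : Kernel (ProbabilityMeasure ℝ × ℝ) ℝ :=
    ⟨fun z => (z.1 : Measure ℝ), measurable_subtype_coe.comp measurable_fst⟩
  have hκ : IsMarkovKernel κ := ⟨fun z => z.1.2⟩
  have hs : MeasurableSet {w : (ProbabilityMeasure ℝ × ℝ) × ℝ | w.2 ≤ w.1.2} :=
    measurableSet_le measurable_snd measurable_fst.snd
  exact (Kernel.measurable_kernel_prodMk_left (κ := κ) hs).ennreal_toReal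

theorem measurable_distFun_left {β : Type*} [MeasurableSpace β] {f : β → ProbabilityMeasure ℝ}
    (hf : Measurable f) (x : ℝ) : Measurable fun b => distFun (f b) x :=
  measurable_distFun.comp (f := fun b => (f b, x)) (hf.prodMk measurable_const)

theorem distFun_nonneg (ν : ProbabilityMeasure ℝ) (x : ℝ) : 0 ≤ distFun ν x := measureReal_nonneg

theorem distFun_le_one (ν : ProbabilityMeasure ℝ) (x : ℝ) : distFun ν x ≤ 1 := measureReal_le_one

theorem bddMeasurable_distFun :
    BddMeasurable fun z : ProbabilityMeasure ℝ × ℝ => distFun z.1 z.2 :=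
  ⟨measurable_distFun, 1, fun z => by
    rw [abs_of_nonneg (distFun_nonneg _ _)]; exact distFun_le_one _ _⟩

namespace ConjugateProcess

variable {Ω : Type*} [mΩ : MeasurableSpace Ω] {P : Measure Ω} (S : ConjugateProcess P)
  (D : SamplingScheme)

theorem Xi_le : S.Xi ≤ mΩ := iSup_le fun t => (S.measurable_ξ t).comap_le

theorem measurable_ξ_Xi (t : ℕ) : Measurable[S.Xi] (S.ξ t) :=
  (comap_measurable (S.ξ t)).mono
    (le_iSup (fun s => (inferInstance : MeasurableSpace (ProbabilityMeasure ℝ)).comap (S.ξ s)) t)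
    le_rfl

theorem bddMeasurable_F (t : ℕ) : BddMeasurable fun z : Ω × ℝ => S.F t z.1 z.2 :=
  bddMeasurable_distFun.comp (φ := fun z : Ω × ℝ => (S.ξ t z.1, z.2))
    (((S.measurable_ξ t).comp measurable_fst).prodMk measurable_snd)

theorem bddMeasurable_F_left (t : ℕ) (x : ℝ) : BddMeasurable fun ω => S.F t ω x :=
  (S.bddMeasurable_F t).comp (φ := fun ω => (ω, x)) measurable_prodMk_right

theorem indicator_Ici_eq (τ : ℝ≥0) (x : ℝ) (ω : Ω) :
    (Set.Ici (S.X τ ω)).indicator (1 : ℝ → ℝ) x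
      = (S.X τ ⁻¹' Set.Iic x).indicator (fun _ => (1 : ℝ)) ω := by
  classical
  rw [Set.indicator_apply, Set.indicator_apply]
  rfl

theorem bddMeasurable_indicator_Ici (τ : ℝ≥0) :
    BddMeasurable fun z : Ω × ℝ => (Set.Ici (S.X τ z.1)).indicator (1 : ℝ → ℝ) z.2 := by
  refine ⟨?_, 1, fun z => ?_⟩
  · have he : (fun z : Ω × ℝ => (Set.Ici (S.X τ z.1)).indicator (1 : ℝ → ℝ) z.2)
        = {z : Ω × ℝ | S.X τ z.1 ≤ z.2}.indicator 1 := by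
      ext z; simp [Set.indicator_apply]
    rw [he]
    exact measurable_one.indicator
      (measurableSet_le ((S.measurable_X τ).comp measurable_fst) measurable_snd)
  · dsimp only; rw [Set.indicator_apply]; split_ifs <;> simp

theorem bddMeasurable_Fhat (t : ℕ) : BddMeasurable fun z : Ω × ℝ => S.Fhat D t z.1 z.2 :=
  (BddMeasurable.const _).mul (BddMeasurable.finset_sum _ fun i _ =>
    S.bddMeasurable_indicator_Ici (D.τ t i))

theorem bddMeasurable_Fhat_left (t : ℕ) (x : ℝ) : BddMeasurable fun ω => S.Fhat D t ω x :=
  (S.bddMeasurable_Fhat D t).comp (φ := fun ω => (ω, x)) measurable_prodMk_right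

theorem Fhat_nonneg (t : ℕ) (ω : Ω) (x : ℝ) : 0 ≤ S.Fhat D t ω x :=
  mul_nonneg (by positivity) (Finset.sum_nonneg fun i _ =>
    Set.indicator_nonneg (fun _ _ => zero_le_one) _)

theorem Fhat_le_one (t : ℕ) (ω : Ω) (x : ℝ) : S.Fhat D t ω x ≤ 1 := by
  have h : ∑ i ∈ Finset.range (D.q t), (Set.Ici (S.X (D.τ t i) ω)).indicator (1 : ℝ → ℝ) x
      ≤ D.q t := by
    refine (Finset.sum_le_card_nsmul _ _ 1 fun i _ => ?_).trans (by simp)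
    rw [Set.indicator_apply]; split_ifs <;> simp
  exact (mul_le_mul_of_nonneg_left h (by positivity)).trans inv_mul_le_one

theorem meanHat_nonneg (n : ℕ) (ω : Ω) (x : ℝ) : 0 ≤ S.meanHat D n ω x :=
  mul_nonneg (by positivity) (Finset.sum_nonneg fun t _ => S.Fhat_nonneg D t ω x)

theorem meanHat_le_one (n : ℕ) (ω : Ω) (x : ℝ) : S.meanHat D n ω x ≤ 1 := by
  have h : ∑ t ∈ Finset.Icc 1 n, S.Fhat D t ω x ≤ n :=
    (Finset.sum_le_card_nsmul _ _ 1 fun t _ => S.Fhat_le_one D t ω x).trans (by simp)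
  exact (mul_le_mul_of_nonneg_left h (by positivity)).trans inv_mul_le_one

theorem bddMeasurable_meanHat (n : ℕ) : BddMeasurable fun z : Ω × ℝ => S.meanHat D n z.1 z.2 :=
  (BddMeasurable.const _).mul (BddMeasurable.finset_sum _ fun t _ => S.bddMeasurable_Fhat D t)

theorem bddMeasurable_meanHat_left (n : ℕ) (x : ℝ) : BddMeasurable fun ω => S.meanHat D n ω x :=
  (S.bddMeasurable_meanHat D n).comp (φ := fun ω => (ω, x)) measurable_prodMk_right

theorem sigmaFhat_le (t : ℕ) : S.sigmaFhat D t ≤ mΩ :=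
  iSup_le fun x => (S.bddMeasurable_Fhat_left D t x).1.comap_le

theorem measurable_Fhat_window {t s p : ℕ} (hs : s ∈ Set.Icc t (t + p)) (x : ℝ) :
    Measurable[⨆ s ∈ Set.Icc t (t + p), S.sigmaFhat D s] fun ω => S.Fhat D s ω x :=
  (comap_measurable fun ω => S.Fhat D s ω x).mono
    ((le_iSup (fun x : ℝ => (borel ℝ).comap fun ω => S.Fhat D s ω x) x).trans
      (le_iSup₂ (f := fun s (_ : s ∈ Set.Icc t (t + p)) => S.sigmaFhat D s) s hs)) le_rfl

theorem measurableSet_preimage_Iic (τ : ℝ≥0) (x : ℝ) : MeasurableSet (S.X τ ⁻¹' Set.Iic x) :=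
  S.measurable_X τ measurableSet_Iic

variable {S} in
theorem IsStationary.integral_F_mul_F (hstat : S.IsStationary) (t k : ℕ) (x y : ℝ) :
    ∫ ω, S.F t ω x * S.F (t + k) ω y ∂P = ∫ ω, S.F 0 ω x * S.F k ω y ∂P := by
  have h := ((hstat t).comp
    (u := fun s : ℕ → ProbabilityMeasure ℝ => distFun (s 0) x * distFun (s k) y)
    ((measurable_distFun_left (measurable_pi_apply 0) x).mul
      (measurable_distFun_left (measurable_pi_apply k) y))).integral_eq
  simp only [Function.comp_def, Nat.zero_add] at h
  rw [add_comm t k]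
  exact h

variable [IsProbabilityMeasure P]

theorem integral_F_zero (x : ℝ) : ∫ ω, S.F 0 ω x ∂P = distFun S.meanMeasure x := by
  have h : (S.meanMeasure : Measure ℝ) (Set.Iic x)
      = ∫⁻ ω, (S.ξ 0 ω : Measure ℝ) (Set.Iic x) ∂P :=
    Measure.bind_apply measurableSet_Iic
      (measurable_subtype_coe.comp (S.measurable_ξ 0)).aemeasurable
  rw [distFun, measureReal_def, h]
  refine integral_toReal ?_ (ae_of_all _ fun ω => measure_lt_top _ _)
  exact ((Measure.measurable_coe measurableSet_Iic).comp
    (measurable_subtype_coe.comp (S.measurable_ξ 0))).aemeasurable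

variable {S} in
theorem IsStationary.integral_F (hstat : S.IsStationary) (t : ℕ) (x : ℝ) :
    ∫ ω, S.F t ω x ∂P = distFun S.meanMeasure x := by
  have h := ((hstat t).comp (u := fun s : ℕ → ProbabilityMeasure ℝ => distFun (s 0) x)
    (measurable_distFun_left (measurable_pi_apply 0) x)).integral_eq
  simp only [Function.comp_def, Nat.zero_add] at h
  exact h.trans (S.integral_F_zero x)

/-- On events of `Ξ`, the empirical and the latent distribution function have the same mean. -/
theorem setIntegral_Fhat {t : ℕ} (ht : 1 ≤ t) (x : ℝ) {A : Set Ω} (hA : MeasurableSet[S.Xi] A) :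
    ∫ ω in A, S.Fhat D t ω x ∂P = ∫ ω in A, S.F t ω x ∂P := by
  have h : ∀ i ∈ Finset.range (D.q t),
      ∫ ω in A, (Set.Ici (S.X (D.τ t i) ω)).indicator (1 : ℝ → ℝ) x ∂P
        = ∫ ω in A, S.F t ω x ∂P := by
    intro i hi
    have hc := S.compatible t (D.τ t i) (D.τ_mem t ht i (Finset.mem_range.1 hi)) (Set.Iic x)
      measurableSet_Iic
    simp_rw [indicator_Ici_eq]
    rw [← setIntegral_condExp S.Xi_le ((integrable_const (1 : ℝ)).indicator
      (S.measurableSet_preimage_Iic _ _)) hA]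
    exact integral_congr_ae (ae_restrict_of_ae hc)
  have hint : ∀ i ∈ Finset.range (D.q t), Integrable
      (fun ω => (Set.Ici (S.X (D.τ t i) ω)).indicator (1 : ℝ → ℝ) x) (P.restrict A) := fun i _ =>
    ((S.bddMeasurable_indicator_Ici (D.τ t i)).comp (φ := fun ω => (ω, x))
      measurable_prodMk_right).integrable _
  have hq : (D.q t : ℝ) ≠ 0 := by have := D.q_pos t ht; positivity
  simp only [Fhat]
  rw [integral_const_mul, integral_finsetSum _ hint, Finset.sum_congr rfl h, Finset.sum_const,
    Finset.card_range, nsmul_eq_mul, inv_mul_cancel_left₀ hq]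

variable {S} in
theorem IsStationary.integral_Fhat (hstat : S.IsStationary) {t : ℕ} (ht : 1 ≤ t) (x : ℝ) :
    ∫ ω, S.Fhat D t ω x ∂P = distFun S.meanMeasure x := by
  have := S.setIntegral_Fhat D ht x (A := Set.univ) MeasurableSet.univ
  rw [Measure.restrict_univ] at this
  rw [this, hstat.integral_F]

variable {S} in
-- For `k ≥ 1` the two observations lie in distinct cycles. Hence the conditional probability of the
-- joint event factorises into the conditional marginals, which are `F t x` and `F (t + k) y`; the
-- tower property concludes.
theorem CyclicIndependent.integral_indicator_mul (hcyc : S.CyclicIndependent) {t k : ℕ}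
    (hk : 1 ≤ k) {τ σ : ℝ≥0} (hτ : τ ∈ Set.Ico (t : ℝ≥0) (t + 1))
    (hσ : σ ∈ Set.Ico ((t + k : ℕ) : ℝ≥0) ((t + k : ℕ) + 1)) (x y : ℝ) :
    ∫ ω, (Set.Ici (S.X τ ω)).indicator (1 : ℝ → ℝ) x *
      (Set.Ici (S.X σ ω)).indicator (1 : ℝ → ℝ) y ∂P = ∫ ω, S.F t ω x * S.F (t + k) ω y ∂P := by
  have hne : t ≠ t + k := by omega
  set A := S.X τ ⁻¹' Set.Iic x with hA
  set B := S.X σ ⁻¹' Set.Iic y with hB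
  let E : ℕ → Set Ω := fun r => if r = t then A else B
  have hEt : E t = A := if_pos rfl
  have hEk : E (t + k) = B := if_neg hne.symm
  have hmem : ∀ (r : ℕ) (ρ : ℝ≥0), ρ ∈ Set.Ico (r : ℝ≥0) (r + 1) → ∀ z : ℝ,
      MeasurableSet[⨆ τ ∈ Set.Ico (r : ℝ≥0) (r + 1), (borel ℝ).comap (S.X τ)]
        (S.X ρ ⁻¹' Set.Iic z) := by
    intro r ρ hρ z
    refine (le_iSup₂ (f := fun τ (_ : τ ∈ Set.Ico (r : ℝ≥0) (r + 1)) =>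
      (borel ℝ).comap (S.X τ)) ρ hρ) _ ?_
    exact ⟨Set.Iic z, (measurableSet_Iic : MeasurableSet (Set.Iic z)), rfl⟩
  have hci := hcyc {t, t + k} E (by
    intro r hr
    rcases Finset.mem_insert.1 hr with rfl | hr
    · rw [hEt]; exact hmem _ _ hτ _
    · rw [Finset.mem_singleton] at hr
      subst hr
      rw [hEk]; exact hmem _ _ hσ _)
  have hinter : (⋂ r ∈ ({t, t + k} : Finset ℕ), E r) = A ∩ B := by
    rw [Finset.set_biInter_insert, Finset.set_biInter_singleton, hEt, hEk]
  rw [hinter, Finset.prod_pair hne, hEt, hEk] at hci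
  have hmA : MeasurableSet A := S.measurableSet_preimage_Iic τ x
  have hmB : MeasurableSet B := S.measurableSet_preimage_Iic σ y
  calc ∫ ω, (Set.Ici (S.X τ ω)).indicator (1 : ℝ → ℝ) x *
        (Set.Ici (S.X σ ω)).indicator (1 : ℝ → ℝ) y ∂P
      = ∫ ω, (A ∩ B).indicator (fun _ => (1 : ℝ)) ω ∂P := by
        simp_rw [indicator_Ici_eq, ← hA, ← hB]
        refine integral_congr_ae (ae_of_all _ fun ω => ?_)
        by_cases h1 : ω ∈ A <;> by_cases h2 : ω ∈ B <;> simp [h1, h2]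
    _ = ∫ ω, (P[(A ∩ B).indicator (fun _ => (1 : ℝ)) | S.Xi]) ω ∂P :=
        (integral_condExp S.Xi_le).symm
    _ = ∫ ω, S.F t ω x * S.F (t + k) ω y ∂P := by
        refine integral_congr_ae ?_
        filter_upwards [hci, S.compatible t τ hτ (Set.Iic x) measurableSet_Iic,
          S.compatible (t + k) σ hσ (Set.Iic y) measurableSet_Iic] with ω h1 h2 h3
        rw [h1, Pi.mul_apply, h2, h3]
        rfl

variable {S} in
-- Every pair of observations contributes the same expectation, so the sample sizes cancel and the
-- lagged products have a mean free of `t`.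
theorem CyclicIndependent.integral_Fhat_mul_Fhat (hcyc : S.CyclicIndependent)
    (hstat : S.IsStationary) {t k : ℕ} (ht : 1 ≤ t) (hk : 1 ≤ k) (x y : ℝ) :
    ∫ ω, S.Fhat D t ω x * S.Fhat D (t + k) ω y ∂P = ∫ ω, S.F 0 ω x * S.F k ω y ∂P := by
  have hq : ∀ r, 1 ≤ r → (D.q r : ℝ) ≠ 0 := fun r hr => by have := D.q_pos r hr; positivity
  have he : ∀ ω, S.Fhat D t ω x * S.Fhat D (t + k) ω y
      = ((D.q t : ℝ)⁻¹ * (D.q (t + k) : ℝ)⁻¹) * ∑ i ∈ Finset.range (D.q t),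
        ∑ l ∈ Finset.range (D.q (t + k)), (Set.Ici (S.X (D.τ t i) ω)).indicator (1 : ℝ → ℝ) x *
          (Set.Ici (S.X (D.τ (t + k) l) ω)).indicator (1 : ℝ → ℝ) y := fun ω => by
    rw [← Finset.sum_mul_sum, Fhat, Fhat]; ring
  have hint : ∀ i l, Integrable (fun ω => (Set.Ici (S.X (D.τ t i) ω)).indicator (1 : ℝ → ℝ) x *
      (Set.Ici (S.X (D.τ (t + k) l) ω)).indicator (1 : ℝ → ℝ) y) P := fun i l =>
    (((S.bddMeasurable_indicator_Ici (D.τ t i)).comp (φ := fun ω => (ω, x))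
      measurable_prodMk_right).mul ((S.bddMeasurable_indicator_Ici (D.τ (t + k) l)).comp
        (φ := fun ω => (ω, y)) measurable_prodMk_right)).integrable P
  simp_rw [he]
  rw [integral_const_mul, integral_finsetSum _ fun i _ => integrable_finsetSum _ fun l _ =>
    hint i l]
  have hin : ∀ i ∈ Finset.range (D.q t), ∫ ω, ∑ l ∈ Finset.range (D.q (t + k)),
      (Set.Ici (S.X (D.τ t i) ω)).indicator (1 : ℝ → ℝ) x *
        (Set.Ici (S.X (D.τ (t + k) l) ω)).indicator (1 : ℝ → ℝ) y ∂P
      = D.q (t + k) * ∫ ω, S.F 0 ω x * S.F k ω y ∂P := by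
    intro i hi
    rw [integral_finsetSum _ fun l _ => hint i l, Finset.sum_congr rfl fun l hl => by
      rw [hcyc.integral_indicator_mul hk (D.τ_mem t ht i (Finset.mem_range.1 hi))
        (D.τ_mem (t + k) (by omega) l (Finset.mem_range.1 hl)), hstat.integral_F_mul_F]]
    simp
  rw [Finset.sum_congr rfl hin, Finset.sum_const, Finset.card_range, nsmul_eq_mul]
  have h1 := hq t ht
  have h2 := hq (t + k) (by omega)
  field_simp

variable {S} in
theorem IsStationary.C_eq (hstat : S.IsStationary) (k : ℕ) (x y : ℝ) :
    S.C k x y = ∫ ω, S.F 0 ω x * S.F k ω y ∂P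
      - distFun S.meanMeasure x * distFun S.meanMeasure y := by
  rw [C, covariance_eq_sub ((S.bddMeasurable_F_left 0 x).memLp P 2)
    ((S.bddMeasurable_F_left k y).memLp P 2), hstat.integral_F, hstat.integral_F]
  rfl

end ConjugateProcess

end Moments

/-! ### Mean square errors of the sample mean, the autocovariances and `Rhat` -/

section MeanSquareError

namespace ConjugateProcess

variable {Ω : Type*} [mΩ : MeasurableSpace Ω] {P : Measure Ω}
  (S : ConjugateProcess P) (D : SamplingScheme)

theorem bddMeasurable_Chat (p n k : ℕ) :
    BddMeasurable fun z : Ω × ℝ × ℝ => S.Chat D p n k z.1 z.2.1 z.2.2 := by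
  have h1 : Measurable fun z : Ω × ℝ × ℝ => (z.1, z.2.1) := by fun_prop
  have h2 : Measurable fun z : Ω × ℝ × ℝ => (z.1, z.2.2) := by fun_prop
  have a1 : ∀ t, BddMeasurable fun z : Ω × ℝ × ℝ => S.Fhat D t z.1 z.2.1 := fun t =>
    (S.bddMeasurable_Fhat D t).comp (φ := fun z : Ω × ℝ × ℝ => (z.1, z.2.1)) h1
  have a2 : ∀ t, BddMeasurable fun z : Ω × ℝ × ℝ => S.Fhat D t z.1 z.2.2 := fun t =>
    (S.bddMeasurable_Fhat D t).comp (φ := fun z : Ω × ℝ × ℝ => (z.1, z.2.2)) h2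
  have m1 : BddMeasurable fun z : Ω × ℝ × ℝ => S.meanHat D n z.1 z.2.1 :=
    (S.bddMeasurable_meanHat D n).comp (φ := fun z : Ω × ℝ × ℝ => (z.1, z.2.1)) h1
  have m2 : BddMeasurable fun z : Ω × ℝ × ℝ => S.meanHat D n z.1 z.2.2 :=
    (S.bddMeasurable_meanHat D n).comp (φ := fun z : Ω × ℝ × ℝ => (z.1, z.2.2)) h2
  unfold Chat
  exact (BddMeasurable.const _).mul (BddMeasurable.finset_sum _ fun t _ =>
    ((a1 t).sub m1).mul ((a2 (t + k)).sub m2))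

theorem abs_Chat_le_one {p n : ℕ} (hn : p < n) (k : ℕ) (ω : Ω) (x y : ℝ) :
    |S.Chat D p n k ω x y| ≤ 1 := by
  have hN : ((n : ℝ) - p) = ((n - p : ℕ) : ℝ) := (Nat.cast_sub hn.le).symm
  have hd : ∀ t z, |S.Fhat D t ω z - S.meanHat D n ω z| ≤ 1 := fun t z => by
    rw [abs_le]
    constructor <;> linarith [S.Fhat_nonneg D t ω z, S.Fhat_le_one D t ω z,
      S.meanHat_nonneg D n ω z, S.meanHat_le_one D n ω z]
  rw [Chat, hN, abs_mul, abs_of_nonneg (by positivity)]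
  have h : |∑ t ∈ Finset.Icc 1 (n - p), (S.Fhat D t ω x - S.meanHat D n ω x) *
      (S.Fhat D (t + k) ω y - S.meanHat D n ω y)| ≤ ((n - p : ℕ) : ℝ) := by
    refine (Finset.abs_sum_le_sum_abs _ _).trans
      ((Finset.sum_le_card_nsmul _ _ 1 fun t _ => ?_).trans (by simp))
    rw [abs_mul]
    exact mul_le_one₀ (hd _ _) (abs_nonneg _) (hd _ _)
  exact (mul_le_mul_of_nonneg_left h (by positivity)).trans inv_mul_le_one

theorem Rhat_comm (μ : Measure ℝ) (p n : ℕ) (ω : Ω) (x y : ℝ) :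
    S.Rhat D μ p n ω x y = S.Rhat D μ p n ω y x := by
  simp only [Rhat, mul_comm]

theorem R_comm (μ : Measure ℝ) (p : ℕ) (x y : ℝ) : S.R μ p x y = S.R μ p y x := by
  simp only [R, mul_comm]

theorem bddMeasurable_Rhat (μ : Measure ℝ) [IsFiniteMeasure μ] (p n : ℕ) :
    BddMeasurable fun z : Ω × ℝ × ℝ => S.Rhat D μ p n z.1 z.2.1 z.2.2 := by
  have h1 : Measurable fun w : (Ω × ℝ × ℝ) × ℝ => (w.1.1, w.1.2.1, w.2) := by fun_prop
  have h2 : Measurable fun w : (Ω × ℝ × ℝ) × ℝ => (w.1.1, w.1.2.2, w.2) := by fun_prop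
  have c1 : ∀ k, BddMeasurable fun w : (Ω × ℝ × ℝ) × ℝ => S.Chat D p n k w.1.1 w.1.2.1 w.2 :=
    fun k => (S.bddMeasurable_Chat D p n k).comp
      (φ := fun w : (Ω × ℝ × ℝ) × ℝ => (w.1.1, w.1.2.1, w.2)) h1
  have c2 : ∀ k, BddMeasurable fun w : (Ω × ℝ × ℝ) × ℝ => S.Chat D p n k w.1.1 w.1.2.2 w.2 :=
    fun k => (S.bddMeasurable_Chat D p n k).comp
      (φ := fun w : (Ω × ℝ × ℝ) × ℝ => (w.1.1, w.1.2.2, w.2)) h2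
  unfold Rhat
  exact BddMeasurable.finset_sum _ fun k _ => BddMeasurable.integral_right
    (F := fun (z : Ω × ℝ × ℝ) w => S.Chat D p n k z.1 z.2.1 w * S.Chat D p n k z.1 z.2.2 w)
    ((c1 k).mul (c2 k)) μ

variable [IsProbabilityMeasure P]

variable {S} in
theorem IsStationary.bddMeasurable_C (hstat : S.IsStationary) (k : ℕ) :
    BddMeasurable fun z : ℝ × ℝ => S.C k z.1 z.2 := by
  simp_rw [hstat.C_eq]
  have h1 : Measurable fun w : (ℝ × ℝ) × Ω => (w.2, w.1.1) := by fun_prop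
  have h2 : Measurable fun w : (ℝ × ℝ) × Ω => (w.2, w.1.2) := by fun_prop
  have hm : Measurable fun x : ℝ => (S.meanMeasure, x) := measurable_prodMk_left
  refine (BddMeasurable.integral_right (F := fun (z : ℝ × ℝ) ω => S.F 0 ω z.1 * S.F k ω z.2)
    (((S.bddMeasurable_F 0).comp h1).mul ((S.bddMeasurable_F k).comp h2)) P).sub ?_
  exact ((bddMeasurable_distFun.comp hm).comp measurable_fst).mul
    ((bddMeasurable_distFun.comp hm).comp measurable_snd)

variable {S} in
theorem IsStationary.abs_C_le_one (hstat : S.IsStationary) (k : ℕ) (x y : ℝ) :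
    |S.C k x y| ≤ 1 := by
  have h0 : 0 ≤ ∫ ω, S.F 0 ω x * S.F k ω y ∂P :=
    integral_nonneg fun ω => mul_nonneg (distFun_nonneg _ _) (distFun_nonneg _ _)
  have h1 : ∫ ω, S.F 0 ω x * S.F k ω y ∂P ≤ ∫ _, (1 : ℝ) ∂P :=
    integral_mono (((S.bddMeasurable_F_left 0 x).mul (S.bddMeasurable_F_left k y)).integrable P)
      (integrable_const _)
      fun ω => mul_le_one₀ (distFun_le_one _ _) (distFun_nonneg _ _) (distFun_le_one _ _)
  simp only [integral_const, probReal_univ, smul_eq_mul, mul_one] at h1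
  have h2 := mul_nonneg (distFun_nonneg S.meanMeasure x) (distFun_nonneg S.meanMeasure y)
  have h3 := mul_le_one₀ (distFun_le_one S.meanMeasure x) (distFun_nonneg S.meanMeasure y)
    (distFun_le_one S.meanMeasure y)
  rw [hstat.C_eq, abs_le]
  constructor <;> linarith

variable {S} in
theorem IsStationary.bddMeasurable_R (hstat : S.IsStationary) (μ : Measure ℝ)
    [IsFiniteMeasure μ] (p : ℕ) : BddMeasurable fun z : ℝ × ℝ => S.R μ p z.1 z.2 := by
  have h1 : Measurable fun w : (ℝ × ℝ) × ℝ => (w.1.1, w.2) := by fun_prop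
  have h2 : Measurable fun w : (ℝ × ℝ) × ℝ => (w.1.2, w.2) := by fun_prop
  exact BddMeasurable.finset_sum _ fun k _ => BddMeasurable.integral_right
    (F := fun (z : ℝ × ℝ) w => S.C k z.1 w * S.C k z.2 w)
    (((hstat.bddMeasurable_C k).comp h1).mul ((hstat.bddMeasurable_C k).comp h2)) μ

variable {S D}

/-- The mean square error of the sample mean and of the sample autocovariances. -/
theorem exists_mse_meanHat_Chat_le (hstat : S.IsStationary) (hcyc : S.CyclicIndependent)
    (hmix : S.IsPsiMixing D) (p : ℕ) :
    ∃ B : ℝ, 0 ≤ B ∧ ∀ n, p < n →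
      (∀ x, ∫ ω, (S.meanHat D n ω x - distFun S.meanMeasure x) ^ 2 ∂P ≤ B / (n - p : ℕ)) ∧
      ∀ k ∈ Finset.Icc 1 p, ∀ x y,
        ∫ ω, (S.Chat D p n k ω x y - S.C k x y) ^ 2 ∂P ≤ B / (n - p : ℕ) := by
  obtain ⟨B, hB0, hB⟩ := exists_integral_sq_avg_sub_le (S.sigmaFhat_le D) p hmix.2
  -- Below, the squared error is at most `20` times a sum of five squares, each of mean at most `B /
  -- N`.
  refine ⟨100 * B, by positivity, fun n hn => ?_⟩
  set N := n - p with hNdef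
  have hN : 1 ≤ N := by omega
  have hNpos : (0 : ℝ) < N := by exact_mod_cast hN
  have hBN : 0 ≤ B / N := by positivity
  -- mean square errors of the basic averages
  have hshift : ∀ k ≤ p, ∀ x, ∀ M : ℕ, 1 ≤ M →
      ∫ ω, ((M : ℝ)⁻¹ * ∑ t ∈ Finset.Icc 1 M, S.Fhat D (t + k) ω x
        - distFun S.meanMeasure x) ^ 2 ∂P ≤ B / M := fun k hk x =>
    hB (fun t ω => S.Fhat D (t + k) ω x) _
      (fun t _ => S.measurable_Fhat_window D ⟨by omega, by omega⟩ x)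
      (fun t ω => S.Fhat_nonneg D _ ω x) (fun t ω => S.Fhat_le_one D _ ω x)
      (fun t ht => hstat.integral_Fhat D (by omega) x)
  have hmean : ∀ x, ∫ ω, (S.meanHat D n ω x - distFun S.meanMeasure x) ^ 2 ∂P ≤ B / N := by
    intro x
    have h := hshift 0 (Nat.zero_le _) x n (by omega)
    simp only [add_zero] at h
    refine h.trans ?_
    gcongr
    omega
  refine ⟨fun x => (hmean x).trans (by rw [mul_div_assoc]; linarith), fun k hk x y => ?_⟩
  obtain ⟨hk1, hkp⟩ := Finset.mem_Icc.1 hk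
  set m := distFun S.meanMeasure with hm
  set c := ∫ ω, S.F 0 ω x * S.F k ω y ∂P with hc
  let A : Ω → ℝ := fun ω => (N : ℝ)⁻¹ * ∑ t ∈ Finset.Icc 1 N, S.Fhat D t ω x * S.Fhat D (t + k) ω y
  let a₁ : Ω → ℝ := fun ω => (N : ℝ)⁻¹ * ∑ t ∈ Finset.Icc 1 N, S.Fhat D (t + 0) ω x
  let a₂ : Ω → ℝ := fun ω => (N : ℝ)⁻¹ * ∑ t ∈ Finset.Icc 1 N, S.Fhat D (t + k) ω y
  have hA : ∫ ω, (A ω - c) ^ 2 ∂P ≤ B / N :=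
    hB (fun t ω => S.Fhat D t ω x * S.Fhat D (t + k) ω y) c
      (fun t _ => (S.measurable_Fhat_window D ⟨by omega, by omega⟩ x).mul
        (S.measurable_Fhat_window D ⟨by omega, by omega⟩ y))
      (fun t ω => mul_nonneg (S.Fhat_nonneg D _ ω x) (S.Fhat_nonneg D _ ω y))
      (fun t ω => mul_le_one₀ (S.Fhat_le_one D _ ω x) (S.Fhat_nonneg D _ ω y)
        (S.Fhat_le_one D _ ω y))
      (fun t ht => hcyc.integral_Fhat_mul_Fhat D hstat ht hk1 x y) N hN
  have ha₁ : ∫ ω, (a₁ ω - m x) ^ 2 ∂P ≤ B / N := hshift 0 (Nat.zero_le _) x N hN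
  have ha₂ : ∫ ω, (a₂ ω - m y) ^ 2 ∂P ≤ B / N := hshift k hkp y N hN
  have hChat : ∀ ω, S.Chat D p n k ω x y = A ω - a₁ ω * S.meanHat D n ω y
      - S.meanHat D n ω x * a₂ ω + S.meanHat D n ω x * S.meanHat D n ω y := by
    intro ω
    have hNc : ((n : ℝ) - p) = (N : ℝ) := (Nat.cast_sub hn.le).symm
    simp only [Chat, A, a₁, a₂, hNc, ← hNdef, add_zero, sub_mul, mul_sub, Finset.sum_sub_distrib,
      ← Finset.sum_mul, ← Finset.mul_sum, Finset.sum_const, Nat.card_Icc, Nat.add_sub_cancel,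
      nsmul_eq_mul]
    rw [mul_assoc (N : ℝ), inv_mul_cancel_left₀ hNpos.ne']
    ring
  have hpt : ∀ ω, (S.Chat D p n k ω x y - S.C k x y) ^ 2 ≤ 20 * ((A ω - c) ^ 2
      + (a₁ ω - m x) ^ 2 + (a₂ ω - m y) ^ 2 + (S.meanHat D n ω x - m x) ^ 2
      + (S.meanHat D n ω y - m y) ^ 2) := by
    intro ω
    rw [hChat, hstat.C_eq, ← hm, ← hc]
    set u := S.meanHat D n ω x with hu
    set v := S.meanHat D n ω y with hv
    have hu0 : 0 ≤ u := S.meanHat_nonneg D n ω x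
    have hu1 : u ≤ 1 := S.meanHat_le_one D n ω x
    have hv0 : 0 ≤ v := S.meanHat_nonneg D n ω y
    have hv1 : v ≤ 1 := S.meanHat_le_one D n ω y
    have hx0 : 0 ≤ m x := distFun_nonneg _ _
    have hx1 : m x ≤ 1 := distFun_le_one _ _
    have hy0 : 0 ≤ m y := distFun_nonneg _ _
    have hy1 : m y ≤ 1 := distFun_le_one _ _
    -- Regrouped so that each term is an error of a basic average times a factor in `[-1, 1]`.
    have he : A ω - a₁ ω * v - u * a₂ ω + u * v - (c - m x * m y)
        = (A ω - c) - v * (a₁ ω - m x) - u * (a₂ ω - m y) + (v - m y) * (u - m x) := by ring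
    have hsq : ∀ {s r : ℝ}, 0 ≤ s → s ≤ 1 → (s * r) ^ 2 ≤ r ^ 2 := fun {s r} h0 h1 => by
      rw [mul_pow]
      exact mul_le_of_le_one_left (sq_nonneg _) (pow_le_one₀ h0 h1)
    have h1 := hsq (r := a₁ ω - m x) hv0 hv1
    have h2 := hsq (r := a₂ ω - m y) hu0 hu1
    have h3 : ((v - m y) * (u - m x)) ^ 2 ≤ (u - m x) ^ 2 := by
      rw [mul_pow]
      refine mul_le_of_le_one_left (sq_nonneg _) ?_
      rw [sq_le_one_iff_abs_le_one, abs_le]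
      constructor <;> linarith
    rw [he]
    set e₀ := A ω - c
    set e₁ := v * (a₁ ω - m x)
    set e₂ := u * (a₂ ω - m y)
    set e₃ := (v - m y) * (u - m x)
    have h4 : (e₀ - e₁ - e₂ + e₃) ^ 2 ≤ 4 * (e₀ ^ 2 + e₁ ^ 2 + e₂ ^ 2 + e₃ ^ 2) := by
      nlinarith [sq_nonneg (e₀ + e₁), sq_nonneg (e₀ + e₂), sq_nonneg (e₀ - e₃),
        sq_nonneg (e₁ - e₂), sq_nonneg (e₁ + e₃), sq_nonneg (e₂ + e₃)]
    linarith [sq_nonneg e₀, sq_nonneg (a₁ ω - m x), sq_nonneg (a₂ ω - m y),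
      sq_nonneg (u - m x), sq_nonneg (v - m y)]
  have hFm := S.bddMeasurable_Fhat_left D
  have iA : BddMeasurable fun ω => (A ω - c) ^ 2 :=
    (((BddMeasurable.const _).mul (BddMeasurable.finset_sum _ fun t _ =>
      (hFm t x).mul (hFm (t + k) y))).sub (BddMeasurable.const c)).sq
  have i₁ : BddMeasurable fun ω => (a₁ ω - m x) ^ 2 :=
    (((BddMeasurable.const _).mul (BddMeasurable.finset_sum _ fun t _ =>
      hFm (t + 0) x)).sub (BddMeasurable.const (m x))).sq
  have i₂ : BddMeasurable fun ω => (a₂ ω - m y) ^ 2 :=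
    (((BddMeasurable.const _).mul (BddMeasurable.finset_sum _ fun t _ =>
      hFm (t + k) y)).sub (BddMeasurable.const (m y))).sq
  have i₃ : ∀ z, BddMeasurable fun ω => (S.meanHat D n ω z - m z) ^ 2 := fun z =>
    ((S.bddMeasurable_meanHat_left D n z).sub (BddMeasurable.const (m z))).sq
  have iC : BddMeasurable fun ω => (S.Chat D p n k ω x y - S.C k x y) ^ 2 :=
    (((S.bddMeasurable_Chat D p n k).comp (φ := fun ω => (ω, x, y))
      measurable_prodMk_right).sub (BddMeasurable.const _)).sq
  have hI := integral_mono (iC.integrable P) (((((iA.add i₁).add i₂).add (i₃ x)).add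
    (i₃ y)).integrable P |>.const_mul 20) hpt
  rw [integral_const_mul, integral_add ((((iA.add i₁).add i₂).add (i₃ x)).integrable P)
    ((i₃ y).integrable P), integral_add (((iA.add i₁).add i₂).integrable P) ((i₃ x).integrable P),
    integral_add ((iA.add i₁).integrable P) (i₂.integrable P),
    integral_add (iA.integrable P) (i₁.integrable P)] at hI
  refine hI.trans ?_
  rw [mul_div_assoc]
  linarith [hmean x, hmean y]

/-- The mean square error of `Rhat` in the Hilbert–Schmidt norm. -/
theorem exists_mse_Rhat_le (hstat : S.IsStationary) (hcyc : S.CyclicIndependent)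
    (hmix : S.IsPsiMixing D) (μ : Measure ℝ) [IsFiniteMeasure μ] (p : ℕ) :
    ∃ B : ℝ, 0 ≤ B ∧ ∀ n, p < n →
      ∫ ω, ∫ x, ∫ y, (S.Rhat D μ p n ω x y - S.R μ p x y) ^ 2 ∂μ ∂μ ∂P ≤ B / (n - p : ℕ) := by
  obtain ⟨B, hB0, hB⟩ := exists_mse_meanHat_Chat_le hstat hcyc hmix p
  set M := μ.real univ with hM
  have hM0 : 0 ≤ M := measureReal_nonneg
  -- `p ^ 2` comes from Cauchy–Schwarz over the lags and their number; one `M` from Cauchy–Schwarz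
  -- in `z` and one for each integration over `z`, `y`, `x`; the `4` from splitting a product
  -- difference into two errors.
  refine ⟨4 * p ^ 2 * M ^ 4 * B, by positivity, fun n hn => ?_⟩
  set N := n - p with hN
  have hBN : 0 ≤ B / N := by positivity
  let E : ℕ → Ω → ℝ → ℝ → ℝ := fun k ω x y => S.Chat D p n k ω x y - S.C k x y
  have hE : ∀ k, BddMeasurable fun z : Ω × ℝ × ℝ => E k z.1 z.2.1 z.2.2 := fun k =>
    (S.bddMeasurable_Chat D p n k).sub
      ((hstat.bddMeasurable_C k).comp (φ := fun z : Ω × ℝ × ℝ => z.2) measurable_snd)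
  have hC := fun k ω x => ((S.bddMeasurable_Chat D p n k).comp (φ := fun z => (ω, x, z))
    (by fun_prop))
  have hC' := fun k x => ((hstat.bddMeasurable_C k).comp (φ := fun z => (x, z)) (by fun_prop))
  have hEx : ∀ k ω x, BddMeasurable fun z => E k ω x z := fun k ω x => (hC k ω x).sub (hC' k x)
  -- pointwise bound
  have hpt : ∀ ω x y, (S.Rhat D μ p n ω x y - S.R μ p x y) ^ 2
      ≤ ∑ k ∈ Finset.Icc 1 p, 2 * p * M * ∫ z, (E k ω x z ^ 2 + E k ω y z ^ 2) ∂μ := by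
    intro ω x y
    have hd : S.Rhat D μ p n ω x y - S.R μ p x y = ∑ k ∈ Finset.Icc 1 p,
        ∫ z, (S.Chat D p n k ω x z * S.Chat D p n k ω y z - S.C k x z * S.C k y z) ∂μ := by
      rw [Rhat, R, ← Finset.sum_sub_distrib]
      refine Finset.sum_congr rfl fun k _ => ?_
      rw [integral_sub (((hC k ω x).mul (hC k ω y)).integrable μ)
        (((hC' k x).mul (hC' k y)).integrable μ)]
    rw [hd]
    refine sq_sum_le_card_mul_sum_sq.trans ?_
    rw [Nat.card_Icc, Nat.add_sub_cancel, Finset.mul_sum]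
    refine Finset.sum_le_sum fun k _ => ?_
    have hcs := sq_integral_le_measure_mul μ (((hC k ω x).mul (hC k ω y)).sub
      ((hC' k x).mul (hC' k y)))
    have hmono : ∫ z, (S.Chat D p n k ω x z * S.Chat D p n k ω y z - S.C k x z * S.C k y z) ^ 2 ∂μ
        ≤ ∫ z, 2 * (E k ω x z ^ 2 + E k ω y z ^ 2) ∂μ := by
      refine integral_mono ((((hC k ω x).mul (hC k ω y)).sub
        ((hC' k x).mul (hC' k y))).sq.integrable μ)
        ((((hEx k ω x).sq.add (hEx k ω y).sq).integrable μ).const_mul 2) fun z => ?_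
      have h1 := S.abs_Chat_le_one D hn k ω y z
      have h2 := hstat.abs_C_le_one k x z
      -- Linearises the product difference; the coefficients `Chat` and `C` are bounded by `1`.
      have he : S.Chat D p n k ω x z * S.Chat D p n k ω y z - S.C k x z * S.C k y z
          = S.Chat D p n k ω y z * E k ω x z + S.C k x z * E k ω y z := by
        simp only [E]; ring
      have h3 : (S.Chat D p n k ω y z * E k ω x z) ^ 2 ≤ E k ω x z ^ 2 := by
        rw [mul_pow]
        exact mul_le_of_le_one_left (sq_nonneg _) ((sq_le_one_iff_abs_le_one _).2 h1)
      have h4 : (S.C k x z * E k ω y z) ^ 2 ≤ E k ω y z ^ 2 := by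
        rw [mul_pow]
        exact mul_le_of_le_one_left (sq_nonneg _) ((sq_le_one_iff_abs_le_one _).2 h2)
      dsimp only
      rw [he]
      nlinarith [sq_nonneg (S.Chat D p n k ω y z * E k ω x z - S.C k x z * E k ω y z)]
    rw [integral_const_mul] at hmono
    calc _ ≤ (p : ℝ) * (M * (2 * ∫ z, (E k ω x z ^ 2 + E k ω y z ^ 2) ∂μ)) := by
          gcongr
          exact hcs.trans (by gcongr)
      _ = _ := by ring
  -- expectation of the bound, for fixed arguments
  have hswap : ∀ k ∈ Finset.Icc 1 p, ∀ x,
      ∫ ω, ∫ z, E k ω x z ^ 2 ∂μ ∂P ≤ M * (B / N) := by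
    intro k hk x
    have hj : BddMeasurable fun w : Ω × ℝ => E k w.1 x w.2 ^ 2 :=
      ((hE k).comp (φ := fun w : Ω × ℝ => (w.1, x, w.2)) (by fun_prop)).sq
    rw [integral_integral_swap (hj.integrable (P.prod μ))]
    have hj' : BddMeasurable fun z => ∫ ω, E k ω x z ^ 2 ∂P :=
      BddMeasurable.integral_right (F := fun z ω => E k ω x z ^ 2)
        (hj.comp (φ := fun w : ℝ × Ω => (w.2, w.1)) (by fun_prop)) P
    calc ∫ z, ∫ ω, E k ω x z ^ 2 ∂P ∂μ ≤ ∫ _, B / N ∂μ :=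
          integral_mono (hj'.integrable μ) (integrable_const _) fun z => (hB n hn).2 k hk x z
      _ = _ := by rw [integral_const, smul_eq_mul]
  have hexp : ∀ x y, ∫ ω, (S.Rhat D μ p n ω x y - S.R μ p x y) ^ 2 ∂P
      ≤ 4 * p ^ 2 * M ^ 2 * (B / N) := by
    intro x y
    have hj : ∀ k x, BddMeasurable fun ω => ∫ z, E k ω x z ^ 2 ∂μ := fun k x =>
      BddMeasurable.integral_right (F := fun ω z => E k ω x z ^ 2)
        ((hE k).comp (φ := fun w : Ω × ℝ => (w.1, x, w.2)) (by fun_prop)).sq μ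
    have hsum : ∀ k ω, ∫ z, (E k ω x z ^ 2 + E k ω y z ^ 2) ∂μ
        = ∫ z, E k ω x z ^ 2 ∂μ + ∫ z, E k ω y z ^ 2 ∂μ := fun k ω =>
      integral_add ((hEx k ω x).sq.integrable μ) ((hEx k ω y).sq.integrable μ)
    have hpt' := fun ω => hpt ω x y
    simp_rw [hsum] at hpt'
    have hi : ∀ k, Integrable (fun ω => 2 * p * M *
        (∫ z, E k ω x z ^ 2 ∂μ + ∫ z, E k ω y z ^ 2 ∂μ)) P := fun k =>
      (((hj k x).add (hj k y)).integrable P).const_mul _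
    have hiR : BddMeasurable fun ω => (S.Rhat D μ p n ω x y - S.R μ p x y) ^ 2 :=
      (((S.bddMeasurable_Rhat D μ p n).comp (φ := fun ω => (ω, x, y))
        measurable_prodMk_right).sub (BddMeasurable.const _)).sq
    calc _ ≤ ∫ ω, ∑ k ∈ Finset.Icc 1 p, 2 * p * M *
          (∫ z, E k ω x z ^ 2 ∂μ + ∫ z, E k ω y z ^ 2 ∂μ) ∂P :=
          integral_mono (hiR.integrable P) (integrable_finsetSum _ fun k _ => hi k)
            hpt'
      _ ≤ ∑ k ∈ Finset.Icc 1 p, 2 * p * M * (M * (B / N) + M * (B / N)) := by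
          rw [integral_finsetSum _ fun k _ => hi k]
          refine Finset.sum_le_sum fun k hk => ?_
          rw [integral_const_mul, integral_add ((hj k x).integrable P) ((hj k y).integrable P)]
          gcongr
          · exact hswap k hk x
          · exact hswap k hk y
      _ = _ := by
          rw [Finset.sum_const, Nat.card_Icc, Nat.add_sub_cancel, nsmul_eq_mul]; ring
  have hRR : BddMeasurable fun z : Ω × ℝ × ℝ =>
      (S.Rhat D μ p n z.1 z.2.1 z.2.2 - S.R μ p z.2.1 z.2.2) ^ 2 :=
    ((S.bddMeasurable_Rhat D μ p n).sub ((hstat.bddMeasurable_R μ p).comp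
      (φ := fun z : Ω × ℝ × ℝ => z.2) measurable_snd)).sq
  have h1 : BddMeasurable fun w : Ω × ℝ =>
      ∫ y, (S.Rhat D μ p n w.1 w.2 y - S.R μ p w.2 y) ^ 2 ∂μ :=
    BddMeasurable.integral_right
      (F := fun (w : Ω × ℝ) y => (S.Rhat D μ p n w.1 w.2 y - S.R μ p w.2 y) ^ 2)
      (hRR.comp (φ := fun w : (Ω × ℝ) × ℝ => (w.1.1, w.1.2, w.2)) (by fun_prop)) μ
  rw [integral_integral_swap (h1.integrable (P.prod μ))]
  have h2 : ∀ x, ∫ ω, ∫ y, (S.Rhat D μ p n ω x y - S.R μ p x y) ^ 2 ∂μ ∂P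
      ≤ 4 * p ^ 2 * M ^ 3 * (B / N) := by
    intro x
    have h3 : BddMeasurable fun w : Ω × ℝ => (S.Rhat D μ p n w.1 x w.2 - S.R μ p x w.2) ^ 2 :=
      hRR.comp (φ := fun w : Ω × ℝ => (w.1, x, w.2)) (by fun_prop)
    rw [integral_integral_swap (h3.integrable (P.prod μ))]
    have h4 : BddMeasurable fun y => ∫ ω, (S.Rhat D μ p n ω x y - S.R μ p x y) ^ 2 ∂P :=
      BddMeasurable.integral_right
        (F := fun y ω => (S.Rhat D μ p n ω x y - S.R μ p x y) ^ 2)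
        (h3.comp (φ := fun w : ℝ × Ω => (w.2, w.1)) (by fun_prop)) P
    calc _ ≤ ∫ _, 4 * p ^ 2 * M ^ 2 * (B / N) ∂μ :=
          integral_mono (h4.integrable μ) (integrable_const _) fun y => hexp x y
      _ = _ := by rw [integral_const, smul_eq_mul, ← hM]; ring
  have h5 : BddMeasurable fun x =>
      ∫ ω, ∫ y, (S.Rhat D μ p n ω x y - S.R μ p x y) ^ 2 ∂μ ∂P :=
    BddMeasurable.integral_right
      (F := fun x ω => ∫ y, (S.Rhat D μ p n ω x y - S.R μ p x y) ^ 2 ∂μ)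
      (h1.comp (φ := fun w : ℝ × Ω => (w.2, w.1)) (by fun_prop)) P
  calc _ ≤ ∫ _, 4 * p ^ 2 * M ^ 3 * (B / N) ∂μ :=
        integral_mono (h5.integrable μ) (integrable_const _) h2
    _ = _ := by rw [integral_const, smul_eq_mul, ← hM]; ring

end ConjugateProcess

end MeanSquareError

/-! ### From mean square errors to rates for the mean and the eigenfunctions -/

section Scores

/-- Markov's inequality as a criterion for stochastic boundedness. -/
theorem isBigOP_of_integral_abs_le {Ω : Type*} [MeasurableSpace Ω] {P : Measure Ω}
    [IsFiniteMeasure P] {Y : ℕ → Ω → ℝ} {a : ℕ → ℝ} {K : ℝ} (hK : 0 < K)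
    (ha : ∀ᶠ n in atTop, 0 < a n) (hY : ∀ᶠ n in atTop, Integrable (Y n) P)
    (h : ∀ᶠ n in atTop, ∫ ω, |Y n ω| ∂P ≤ K * a n) : IsBigOP P Y a := by
  intro ε hε
  refine ⟨K / ε, ?_⟩
  filter_upwards [ha, hY, h] with n han hYn hn
  have h1 := mul_meas_ge_le_integral_of_nonneg (ae_of_all P fun ω => abs_nonneg (Y n ω))
    hYn.abs (K / ε * a n)
  have h2 : P.real {ω | K / ε * a n ≤ |Y n ω|} ≤ ε := by
    have h3 : K / ε * a n * P.real {ω | K / ε * a n ≤ |Y n ω|} ≤ K / ε * a n * ε := by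
      refine (h1.trans hn).trans_eq ?_
      field_simp
    exact le_of_mul_le_mul_left h3 (by positivity)
  refine (measure_mono fun ω hω => ?_).trans (ENNReal.le_ofReal_iff_toReal_le (measure_ne_top _ _)
    hε.le |>.2 h2)
  exact (show K / ε * a n < |Y n ω| from hω).le

theorem integral_le_of_integral_sq_le {Ω : Type*} [MeasurableSpace Ω] {P : Measure Ω}
    [IsProbabilityMeasure P] {u : Ω → ℝ} {b s : ℝ} (hs : 0 < s) (hu : Integrable u P)
    (hu2 : Integrable (fun ω => u ω ^ 2) P) (h : ∫ ω, u ω ^ 2 ∂P ≤ b * s ^ 2) :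
    ∫ ω, u ω ∂P ≤ (1 + b) / 2 * s := by
  -- Young's inequality with weight `s`, chosen so that both terms have mean of order `s`.
  have hpt : ∀ ω, u ω ≤ s / 2 + (2 * s)⁻¹ * u ω ^ 2 := fun ω => by
    have : s / 2 + (2 * s)⁻¹ * u ω ^ 2 - u ω = (2 * s)⁻¹ * (u ω - s) ^ 2 := by
      field_simp; ring
    have h2 : 0 ≤ (2 * s)⁻¹ * (u ω - s) ^ 2 := by positivity
    linarith
  calc ∫ ω, u ω ∂P ≤ ∫ ω, (s / 2 + (2 * s)⁻¹ * u ω ^ 2) ∂P :=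
        integral_mono hu ((integrable_const _).add (hu2.const_mul _)) hpt
    _ = s / 2 + (2 * s)⁻¹ * ∫ ω, u ω ^ 2 ∂P := by
        rw [integral_add (integrable_const _) (hu2.const_mul _), integral_const_mul]
        simp
    _ ≤ s / 2 + (2 * s)⁻¹ * (b * s ^ 2) := by gcongr
    _ = _ := by field_simp

theorem norm_toLp_le_of_mem_Icc {μ : Measure ℝ} [IsFiniteMeasure μ] {f : ℝ → ℝ}
    (hf : MemLp f 2 μ) (h0 : ∀ x, 0 ≤ f x) (h1 : ∀ x, f x ≤ 1) :
    ‖hf.toLp f‖ ≤ √(μ.real univ) := by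
  refine Real.le_sqrt_of_sq_le ?_
  rw [norm_toLp_sq]
  calc ∫ x, f x ^ 2 ∂μ ≤ ∫ _, (1 : ℝ) ∂μ :=
        integral_mono hf.integrable_sq (integrable_const _) fun x => pow_le_one₀ (h0 x) (h1 x)
    _ = μ.real univ := by simp

namespace ConjugateProcess

variable {Ω : Type*} [mΩ : MeasurableSpace Ω] {P : Measure Ω}
  (S : ConjugateProcess P) (D : SamplingScheme) (μ : Measure ℝ) [IsFiniteMeasure μ]

theorem norm_distL2_le (ν : ProbabilityMeasure ℝ) : ‖distL2 μ ν‖ ≤ √(μ.real univ) :=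
  norm_toLp_le_of_mem_Icc _ (distFun_nonneg ν) (distFun_le_one ν)

theorem norm_FhatL2_le (t : ℕ) (ω : Ω) : ‖S.FhatL2 D μ t ω‖ ≤ √(μ.real univ) :=
  norm_toLp_le_of_mem_Icc _ (S.Fhat_nonneg D t ω) (S.Fhat_le_one D t ω)

theorem norm_meanHatL2_le (n : ℕ) (ω : Ω) : ‖S.meanHatL2 D μ n ω‖ ≤ √(μ.real univ) := by
  have h : ‖∑ t ∈ Finset.Icc 1 n, S.FhatL2 D μ t ω‖ ≤ n * √(μ.real univ) :=
    (norm_sum_le _ _).trans ((Finset.sum_le_card_nsmul _ _ _ fun t _ =>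
      S.norm_FhatL2_le D μ t ω).trans (by simp))
  rw [meanHatL2, norm_smul, norm_inv, Real.norm_natCast]
  calc (n : ℝ)⁻¹ * ‖∑ t ∈ Finset.Icc 1 n, S.FhatL2 D μ t ω‖
      ≤ (n : ℝ)⁻¹ * (n * √(μ.real univ)) := by gcongr
    _ = ((n : ℝ)⁻¹ * n) * √(μ.real univ) := by ring
    _ ≤ 1 * √(μ.real univ) := by
        gcongr
        exact inv_mul_le_one
    _ = _ := one_mul _

theorem stronglyMeasurable_FhatL2 (t : ℕ) : StronglyMeasurable (S.FhatL2 D μ t) :=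
  stronglyMeasurable_toLp (S.bddMeasurable_Fhat D t) (S.memLp_Fhat D μ t)

theorem stronglyMeasurable_meanHatL2 (n : ℕ) : StronglyMeasurable (S.meanHatL2 D μ n) :=
  (Finset.stronglyMeasurable_fun_sum _ fun t _ => S.stronglyMeasurable_FhatL2 D μ t).const_smul
    ((n : ℝ)⁻¹)

theorem coeFn_meanHatL2 (n : ℕ) (ω : Ω) : S.meanHatL2 D μ n ω =ᵐ[μ] S.meanHat D n ω := by
  have h : ∀ᵐ x ∂μ, ∀ t ∈ Finset.Icc 1 n, S.FhatL2 D μ t ω x = S.Fhat D t ω x :=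
    (Finset.eventually_all _).2 fun t _ => (S.memLp_Fhat D μ t ω).coeFn_toLp
  filter_upwards [Lp.coeFn_smul (n : ℝ)⁻¹ (∑ t ∈ Finset.Icc 1 n, S.FhatL2 D μ t ω),
    Lp.coeFn_finsetSum (Finset.Icc 1 n) fun t => S.FhatL2 D μ t ω, h] with x h1 h2 h3
  rw [meanHatL2, h1, Pi.smul_apply, h2, Finset.sum_apply, Finset.sum_congr rfl h3, smul_eq_mul,
    meanHat]

/-- The empirical distribution function is conditionally unbiased in `L²(μ)`. -/
theorem condExp_inner_FhatL2 [IsProbabilityMeasure P] {t : ℕ} (ht : 1 ≤ t) (ψ : Lp ℝ 2 μ) :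
    P[fun ω => ⟪S.FhatL2 D μ t ω, ψ⟫ | S.Xi] =ᵐ[P] fun ω => ⟪S.FL2 μ t ω, ψ⟫ := by
  have hl : ∀ ω, ⟪S.FhatL2 D μ t ω, ψ⟫ = ∫ x, S.Fhat D t ω x * ψ x ∂μ := fun ω =>
    inner_toLp_left (S.memLp_Fhat D μ t ω) ψ
  have hr : ∀ ω, ⟪S.FL2 μ t ω, ψ⟫ = ∫ x, S.F t ω x * ψ x ∂μ := fun ω =>
    inner_toLp_left (memLp_distFun μ (S.ξ t ω)) ψ
  have hmeas : Measurable fun ν : ProbabilityMeasure ℝ => ∫ x, distFun ν x * ψ x ∂μ :=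
    (StronglyMeasurable.integral_prod_right'
      (f := fun z : ProbabilityMeasure ℝ × ℝ => distFun z.1 z.2 * ψ z.2)
      (measurable_distFun.mul
        ((Lp.stronglyMeasurable ψ).measurable.comp measurable_snd)).stronglyMeasurable).measurable
  have hgm : Measurable[S.Xi] fun ω => ⟪S.FL2 μ t ω, ψ⟫ := by
    simp_rw [hr]
    exact hmeas.comp (S.measurable_ξ_Xi t)
  have hbd : ∀ f : Lp ℝ 2 μ, ‖f‖ ≤ √(μ.real univ) → ‖⟪f, ψ⟫‖ ≤ √(μ.real univ) * ‖ψ‖ :=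
    fun f hf => (norm_inner_le_norm _ _).trans (by gcongr)
  have hfi : Integrable (fun ω => ⟪S.FhatL2 D μ t ω, ψ⟫) P :=
    Integrable.of_bound
      ((S.stronglyMeasurable_FhatL2 D μ t).inner stronglyMeasurable_const).aestronglyMeasurable _
      (ae_of_all _ fun ω => hbd _ (S.norm_FhatL2_le D μ t ω))
  have hgi : Integrable (fun ω => ⟪S.FL2 μ t ω, ψ⟫) P :=
    Integrable.of_bound (hgm.mono S.Xi_le le_rfl).aestronglyMeasurable _
      (ae_of_all _ fun ω => hbd _ (norm_distL2_le μ _))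
  refine (ae_eq_condExp_of_forall_setIntegral_eq S.Xi_le hfi (fun _ _ _ => hgi.integrableOn)
    (fun A hA _ => ?_) hgm.aestronglyMeasurable).symm
  simp_rw [hl, hr]
  -- Fubini reduces the claim on `A` to the pointwise unbiasedness at each `x`.
  have hswap : ∀ {G : Ω → ℝ → ℝ}, BddMeasurable (fun z : Ω × ℝ => G z.1 z.2) →
      ∫ ω in A, ∫ x, G ω x * ψ x ∂μ ∂P = ∫ x, (∫ ω in A, G ω x ∂P) * ψ x ∂μ := by
    rintro G ⟨hG, B, hB⟩
    have hi : Integrable (fun z : Ω × ℝ => G z.1 z.2 * ψ z.2) ((P.restrict A).prod μ) :=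
      ((integrable_Lp ψ).comp_snd (P.restrict A)).bdd_mul hG.aestronglyMeasurable (ae_of_all _ hB)
    rw [integral_integral_swap hi]
    simp_rw [integral_mul_const]
  rw [hswap (S.bddMeasurable_F t), hswap (S.bddMeasurable_Fhat D t)]
  simp_rw [S.setIntegral_Fhat D ht _ hA]

variable {S D}

/-- Eigenfunctions of `Rhat` for a simple nonzero eigenvalue of `R` are controlled by the
Hilbert–Schmidt distance of the kernels. -/
theorem exists_norm_eigenfunction_sub_le [IsProbabilityMeasure P] (hstat : S.IsStationary) {p : ℕ}
    {θ : ℕ → ℝ} {ψ : ℕ → Lp ℝ 2 μ} (hψ : IsEigenSystem μ (S.R μ p) θ ψ)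
    (hdistinct : ∀ i j, θ i ≠ 0 → θ i = θ j → i = j) (j : ℕ) (hj : 0 < θ j) :
    ∃ C : ℝ, 0 ≤ C ∧ ∀ (n : ℕ) (ω : Ω) (θ' : ℕ → ℝ) (ψ' : ℕ → Lp ℝ 2 μ),
      IsEigenSystem μ (S.Rhat D μ p n ω) θ' ψ' → 0 ≤ ⟪ψ' j, ψ j⟫ →
      ‖ψ' j - ψ j‖ ≤ C * √(∫ x, ∫ y, (S.Rhat D μ p n ω x y - S.R μ p x y) ^ 2 ∂μ ∂μ) := by
  have hR := hstat.bddMeasurable_R μ p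
  obtain ⟨T, hT⟩ := exists_kernelOperator (μ := μ) hR
  obtain ⟨C, hC0, hC⟩ := exists_norm_eigenvector_sub_le (isCompactOperator_kernelOperator hR hT)
    (inner_kernelOperator_comm hR (S.R_comm μ p) hT) hψ.orthonormal
    (fun i => (hT _).unique (hψ.eigen i)) hψ.antitone hψ.nonneg
    (fun c f hc hf => hψ.exhaustive c f hc (hf ▸ hT f)) hdistinct j hj
  refine ⟨C, hC0, fun n ω θ' ψ' h' hs => ?_⟩
  have hR' : BddMeasurable fun z : ℝ × ℝ => S.Rhat D μ p n ω z.1 z.2 :=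
    (S.bddMeasurable_Rhat D μ p n).comp (φ := fun z : ℝ × ℝ => (ω, z.1, z.2)) (by fun_prop)
  obtain ⟨T', hT'⟩ := exists_kernelOperator (μ := μ) hR'
  refine hC T' θ' ψ' _ (isCompactOperator_kernelOperator hR' hT')
    (inner_kernelOperator_comm hR' (S.Rhat_comm D μ p n ω) hT') h'.orthonormal
    (fun i => (hT' _).unique (h'.eigen i)) h'.antitone h'.nonneg
    (fun c f hc hf => h'.exhaustive c f hc (hf ▸ hT' f)) (fun f => ?_) hs
  rw [norm_sub_rev]
  exact ((hT' f).sub hR' hR (hT f)).norm_le (hR'.sub hR)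

/-- Passes from the effective sample size `n - p` to `n`, since `n ≤ (p + 1) * (n - p)` for every `n
> p`. -/
theorem div_sub_le_mul_rpow {n p : ℕ} (hn : p < n) {B : ℝ} (hB : 0 ≤ B) :
    B / (n - p : ℕ) ≤ B * (p + 1) * ((n : ℝ) ^ (-(1 / 2) : ℝ)) ^ 2 := by
  have hn0 : (0 : ℝ) < n := by exact_mod_cast (Nat.zero_le p).trans_lt hn
  have hs2 : ((n : ℝ) ^ (-(1 / 2) : ℝ)) ^ 2 = (n : ℝ)⁻¹ := by
    rw [← Real.rpow_natCast, ← Real.rpow_mul hn0.le]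
    norm_num [Real.rpow_neg_one]
  have hN : (0 : ℝ) < ((n - p : ℕ) : ℝ) := by exact_mod_cast Nat.sub_pos_of_lt hn
  have hle : (n : ℝ) ≤ (p + 1) * ((n - p : ℕ) : ℝ) := by
    have : n ≤ (p + 1) * (n - p) := by
      obtain ⟨d, rfl⟩ := Nat.exists_eq_add_of_lt hn
      have : p + d + 1 - p = d + 1 := by omega
      rw [this]; nlinarith
    exact_mod_cast this
  rw [hs2, div_le_iff₀ hN]
  calc B = B * ((n : ℝ) * (n : ℝ)⁻¹) := by rw [mul_inv_cancel₀ hn0.ne', mul_one]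
    _ ≤ B * ((p + 1) * ((n - p : ℕ) : ℝ) * (n : ℝ)⁻¹) := by gcongr
    _ = _ := by ring

/-- The rate of convergence of the sample mean. -/
theorem exists_integral_norm_meanHatL2_sub_le [IsProbabilityMeasure P] (hstat : S.IsStationary)
    (hcyc : S.CyclicIndependent) (hmix : S.IsPsiMixing D) (p : ℕ) :
    ∃ K : ℝ, 0 < K ∧ ∀ n, p < n →
      Integrable (fun ω => ‖S.meanHatL2 D μ n ω - S.meanL2 μ‖) P ∧
      ∫ ω, ‖S.meanHatL2 D μ n ω - S.meanL2 μ‖ ∂P ≤ K * (n : ℝ) ^ (-(1 / 2) : ℝ) := by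
  obtain ⟨B₁, hB₁0, hB₁⟩ := exists_mse_meanHat_Chat_le hstat hcyc hmix p
  set c := √(μ.real univ) with hc
  set b₁ := μ.real univ * B₁ * (p + 1) with hb₁
  have hb₁0 : 0 ≤ b₁ := by have : 0 ≤ μ.real univ := measureReal_nonneg; positivity
  refine ⟨(1 + b₁) / 2, by positivity, fun n hn => ?_⟩
  have hn0 : (0 : ℝ) < n := by exact_mod_cast (Nat.zero_le p).trans_lt hn
  have hrate := div_sub_le_mul_rpow hn hB₁0
  set s := (n : ℝ) ^ (-(1 / 2) : ℝ) with hs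
  have hs0 : 0 < s := Real.rpow_pos_of_pos hn0 _
  have hu_meas := (S.stronglyMeasurable_meanHatL2 D μ n).sub
    (stronglyMeasurable_const (b := S.meanL2 μ))
  have hu_int : Integrable (fun ω => ‖S.meanHatL2 D μ n ω - S.meanL2 μ‖) P :=
    Integrable.of_bound hu_meas.norm.aestronglyMeasurable (c + c) (ae_of_all _ fun ω => by
      rw [norm_norm]
      exact (norm_sub_le _ _).trans
        (add_le_add (S.norm_meanHatL2_le D μ n ω) (norm_distL2_le μ _)))
  have hu_sq : ∀ ω, ‖S.meanHatL2 D μ n ω - S.meanL2 μ‖ ^ 2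
      = ∫ x, (S.meanHat D n ω x - distFun S.meanMeasure x) ^ 2 ∂μ := by
    intro ω
    rw [norm_Lp_sq]
    refine integral_congr_ae ?_
    filter_upwards [Lp.coeFn_sub (S.meanHatL2 D μ n ω) (S.meanL2 μ), S.coeFn_meanHatL2 D μ n ω,
      (memLp_distFun μ S.meanMeasure).coeFn_toLp] with x h1 h2 h3
    rw [h1, Pi.sub_apply, h2]
    exact congrArg (fun r => (S.meanHat D n ω x - r) ^ 2) h3
  have hm : BddMeasurable fun x => distFun S.meanMeasure x :=
    bddMeasurable_distFun.comp (φ := fun x : ℝ => (S.meanMeasure, x)) measurable_prodMk_left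
  have hw : BddMeasurable fun z : Ω × ℝ =>
      (S.meanHat D n z.1 z.2 - distFun S.meanMeasure z.2) ^ 2 :=
    ((S.bddMeasurable_meanHat D n).sub
      (hm.comp (φ := fun z : Ω × ℝ => z.2) measurable_snd)).sq
  have hu2_int : Integrable (fun ω => ‖S.meanHatL2 D μ n ω - S.meanL2 μ‖ ^ 2) P := by
    simp_rw [hu_sq]
    exact (BddMeasurable.integral_right
      (F := fun ω x => (S.meanHat D n ω x - distFun S.meanMeasure x) ^ 2) hw μ).integrable P
  have hu2 : ∫ ω, ‖S.meanHatL2 D μ n ω - S.meanL2 μ‖ ^ 2 ∂P ≤ b₁ * s ^ 2 := by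
    simp_rw [hu_sq]
    rw [integral_integral_swap (hw.integrable (P.prod μ))]
    have hw' : BddMeasurable fun x =>
        ∫ ω, (S.meanHat D n ω x - distFun S.meanMeasure x) ^ 2 ∂P :=
      BddMeasurable.integral_right
        (F := fun x ω => (S.meanHat D n ω x - distFun S.meanMeasure x) ^ 2)
        (hw.comp (φ := fun z : ℝ × Ω => (z.2, z.1)) measurable_swap) P
    calc _ ≤ ∫ _, B₁ * (p + 1) * s ^ 2 ∂μ :=
          integral_mono (hw'.integrable μ) (integrable_const _) fun x =>
            ((hB₁ n hn).1 x).trans hrate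
      _ = b₁ * s ^ 2 := by rw [integral_const, smul_eq_mul, hb₁]; ring
  exact ⟨hu_int, integral_le_of_integral_sq_le hs0 hu_int hu2_int hu2⟩

/-- The rate of convergence of the estimated eigenfunctions. -/
theorem exists_integral_norm_eigenfunction_sub_le [IsProbabilityMeasure P] (hstat : S.IsStationary)
    (hcyc : S.CyclicIndependent) (hmix : S.IsPsiMixing D) {p : ℕ}
    {θ : ℕ → ℝ} {ψ : ℕ → Lp ℝ 2 μ} (hψ : IsEigenSystem μ (S.R μ p) θ ψ)
    (hdistinct : ∀ i j, θ i ≠ 0 → θ i = θ j → i = j)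
    {θhat : ℕ → ℕ → Ω → ℝ} {ψhat : ℕ → ℕ → Ω → Lp ℝ 2 μ}
    (hmeas : ∀ n j, AEStronglyMeasurable (ψhat n j) P)
    (hψhat : ∀ n, p < n → ∀ᵐ ω ∂P,
      IsEigenSystem μ (S.Rhat D μ p n ω) (fun j => θhat n j ω) (fun j => ψhat n j ω))
    (hsign : ∀ n, p < n → ∀ j, 0 < θ j → ∀ᵐ ω ∂P, 0 ≤ ⟪ψhat n j ω, ψ j⟫)
    (j : ℕ) (hj : 0 < θ j) :
    ∃ K : ℝ, 0 < K ∧ ∀ n, p < n →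
      Integrable (fun ω => ‖ψhat n j ω - ψ j‖) P ∧
      ∫ ω, ‖ψhat n j ω - ψ j‖ ∂P ≤ K * (n : ℝ) ^ (-(1 / 2) : ℝ) := by
  obtain ⟨C, hC0, hC⟩ := exists_norm_eigenfunction_sub_le (D := D) μ hstat hψ hdistinct j hj
  obtain ⟨B₂, hB₂0, hB₂⟩ := exists_mse_Rhat_le hstat hcyc hmix μ p
  set b₂ := B₂ * (p + 1) with hb₂
  have hb₂0 : 0 ≤ b₂ := by positivity
  -- The `+ 1` only ensures positivity, as `C` may vanish.
  refine ⟨C * ((1 + b₂) / 2) + 1, by positivity, fun n hn => ?_⟩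
  have hn0 : (0 : ℝ) < n := by exact_mod_cast (Nat.zero_le p).trans_lt hn
  have hrate := div_sub_le_mul_rpow hn hB₂0
  set s := (n : ℝ) ^ (-(1 / 2) : ℝ) with hs
  have hs0 : 0 < s := Real.rpow_pos_of_pos hn0 _
  let δ : Ω → ℝ := fun ω => √(∫ x, ∫ y, (S.Rhat D μ p n ω x y - S.R μ p x y) ^ 2 ∂μ ∂μ)
  have hδ2 : ∀ ω, δ ω ^ 2 = ∫ x, ∫ y, (S.Rhat D μ p n ω x y - S.R μ p x y) ^ 2 ∂μ ∂μ := fun ω =>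
    Real.sq_sqrt (integral_nonneg fun x => integral_nonneg fun y => sq_nonneg _)
  have hRR : BddMeasurable fun z : Ω × ℝ × ℝ =>
      (S.Rhat D μ p n z.1 z.2.1 z.2.2 - S.R μ p z.2.1 z.2.2) ^ 2 :=
    ((S.bddMeasurable_Rhat D μ p n).sub ((hstat.bddMeasurable_R μ p).comp
      (φ := fun z : Ω × ℝ × ℝ => z.2) measurable_snd)).sq
  have hH : BddMeasurable fun ω =>
      ∫ x, ∫ y, (S.Rhat D μ p n ω x y - S.R μ p x y) ^ 2 ∂μ ∂μ :=
    BddMeasurable.integral_right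
      (F := fun ω x => ∫ y, (S.Rhat D μ p n ω x y - S.R μ p x y) ^ 2 ∂μ)
      (BddMeasurable.integral_right
        (F := fun (w : Ω × ℝ) y => (S.Rhat D μ p n w.1 w.2 y - S.R μ p w.2 y) ^ 2)
        (hRR.comp (φ := fun w : (Ω × ℝ) × ℝ => (w.1.1, w.1.2, w.2)) (by fun_prop)) μ) μ
  have hδ : BddMeasurable δ := by
    obtain ⟨h1, B, hB⟩ := hH
    refine ⟨h1.sqrt, √B, fun ω => ?_⟩
    rw [abs_of_nonneg (Real.sqrt_nonneg _)]
    exact Real.sqrt_le_sqrt ((le_abs_self _).trans (hB ω))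
  have hδ_int : ∫ ω, δ ω ∂P ≤ (1 + b₂) / 2 * s := by
    refine integral_le_of_integral_sq_le hs0 (hδ.integrable P) (hδ.sq.integrable P) ?_
    simp_rw [hδ2]
    exact (hB₂ n hn).trans hrate
  have hψδ : ∀ᵐ ω ∂P, ‖ψhat n j ω - ψ j‖ ≤ C * δ ω := by
    filter_upwards [hψhat n hn, hsign n hn j hj] with ω h1 h2
    exact hC n ω (fun i => θhat n i ω) (fun i => ψhat n i ω) h1 h2
  have hv_int : Integrable (fun ω => ‖ψhat n j ω - ψ j‖) P :=
    ((hδ.integrable P).const_mul C).mono' ((hmeas n j).sub aestronglyMeasurable_const).norm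
      (hψδ.mono fun ω h => by rwa [norm_norm])
  refine ⟨hv_int, ?_⟩
  have hv : ∫ ω, ‖ψhat n j ω - ψ j‖ ∂P ≤ C * ((1 + b₂) / 2 * s) := by
    calc _ ≤ ∫ ω, C * δ ω ∂P := integral_mono_ae hv_int ((hδ.integrable P).const_mul C) hψδ
      _ = C * ∫ ω, δ ω ∂P := integral_const_mul _ _
      _ ≤ _ := by gcongr
  linarith

/-- The common error bound of the estimated scores, and its rate. -/
theorem exists_integral_score_error_le [IsProbabilityMeasure P] (hstat : S.IsStationary)
    (hcyc : S.CyclicIndependent) (hmix : S.IsPsiMixing D) {p : ℕ}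
    {θ : ℕ → ℝ} {ψ : ℕ → Lp ℝ 2 μ} (hψ : IsEigenSystem μ (S.R μ p) θ ψ)
    (hdistinct : ∀ i j, θ i ≠ 0 → θ i = θ j → i = j)
    {θhat : ℕ → ℕ → Ω → ℝ} {ψhat : ℕ → ℕ → Ω → Lp ℝ 2 μ}
    (hmeas : ∀ n j, AEStronglyMeasurable (ψhat n j) P)
    (hψhat : ∀ n, p < n → ∀ᵐ ω ∂P,
      IsEigenSystem μ (S.Rhat D μ p n ω) (fun j => θhat n j ω) (fun j => ψhat n j ω))
    (hsign : ∀ n, p < n → ∀ j, 0 < θ j → ∀ᵐ ω ∂P, 0 ≤ ⟪ψhat n j ω, ψ j⟫)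
    (j : ℕ) (hj : 0 < θ j) :
    ∃ K : ℝ, 0 < K ∧ ∀ n, p < n →
      Integrable (fun ω => 2 * √(μ.real univ) * ‖ψhat n j ω - ψ j‖
        + ‖S.meanHatL2 D μ n ω - S.meanL2 μ‖) P ∧
      ∫ ω, (2 * √(μ.real univ) * ‖ψhat n j ω - ψ j‖ + ‖S.meanHatL2 D μ n ω - S.meanL2 μ‖) ∂P
        ≤ K * (n : ℝ) ^ (-(1 / 2) : ℝ) := by
  obtain ⟨K₁, hK₁0, hK₁⟩ := exists_integral_norm_meanHatL2_sub_le μ hstat hcyc hmix p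
  obtain ⟨K₂, hK₂0, hK₂⟩ := exists_integral_norm_eigenfunction_sub_le μ hstat hcyc hmix hψ
    hdistinct hmeas hψhat hsign j hj
  have hc0 : 0 ≤ √(μ.real univ) := Real.sqrt_nonneg _
  refine ⟨2 * √(μ.real univ) * K₂ + K₁, by positivity, fun n hn => ?_⟩
  obtain ⟨i₁, h₁⟩ := hK₁ n hn
  obtain ⟨i₂, h₂⟩ := hK₂ n hn
  refine ⟨(i₂.const_mul _).add i₁, ?_⟩
  rw [integral_add (i₂.const_mul _) i₁, integral_const_mul]
  have := mul_le_mul_of_nonneg_left h₂ (mul_nonneg zero_le_two hc0)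
  linarith

end ConjugateProcess

end Scores

/-! ### The main theorem -/

theorem mainTheorem8 {Ω : Type*} [MeasurableSpace Ω] (P : Measure Ω) [IsProbabilityMeasure P]
    (S : ConjugateProcess P) (D : SamplingScheme)
    (μ : Measure ℝ) [IsFiniteMeasure μ] (p : ℕ) (hp : 1 ≤ p)
    -- standing assumptions on the process
    (hstat : S.IsStationary) (hcyc : S.CyclicIndependent) (hμ : S.IsDiffraction μ)
    (hR : RangeEquivalent μ (S.R μ p) (S.C 0))
    (herg : S.IsErgodicInProb) (hmix : S.IsPsiMixing D)
    -- eigenvalues and eigenfunctions of `R`; the nonzero eigenvalues are simple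
    (θ : ℕ → ℝ) (ψ : ℕ → Lp ℝ 2 μ) (hψ : IsEigenSystem μ (S.R μ p) θ ψ)
    (hdistinct : ∀ i j, θ i ≠ 0 → θ i = θ j → i = j)
    -- eigenvalues and eigenfunctions of `Rhat`, the latter with the right choice of sign
    (θhat : ℕ → ℕ → Ω → ℝ) (ψhat : ℕ → ℕ → Ω → Lp ℝ 2 μ)
    (hmeas : ∀ n j, AEStronglyMeasurable (ψhat n j) P)
    (hψhat : ∀ n, p < n → ∀ᵐ ω ∂P,
      IsEigenSystem μ (S.Rhat D μ p n ω) (fun j => θhat n j ω) (fun j => ψhat n j ω))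
    (hsign : ∀ n, p < n → ∀ j, 0 < θ j → ∀ᵐ ω ∂P, 0 ≤ ⟪ψhat n j ω, ψ j⟫)
    (j : ℕ) (hj : 0 < θ j) :
    (∃ r : ℕ → Ω → ℝ, (∀ n, AEMeasurable (r n) P) ∧
      IsBigOP P r (fun n => (n : ℝ) ^ (-(1 / 2) : ℝ)) ∧
      ∀ n, p < n → ∀ t, 1 ≤ t → t ≤ n → ∀ᵐ ω ∂P,
        |(P[S.What D n (ψhat n j) t | S.Xi]) ω - S.W (ψ j) t ω| ≤ r n ω) ∧
    (∃ r : ℕ → Ω → ℝ, (∀ n, AEMeasurable (r n) P) ∧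
      IsBigOP P r (fun n => (n : ℝ) ^ (-(1 / 2) : ℝ)) ∧
      ∀ n, p < n → ∀ t, 1 ≤ t → t ≤ n → ∀ᵐ ω ∂P,
        |S.What D n (ψhat n j) t ω - S.W (ψ j) t ω|
          ≤ ‖S.FhatL2 D μ t ω - S.FL2 μ t ω‖ + r n ω) := by
  obtain ⟨K, hK0, hK⟩ := ConjugateProcess.exists_integral_score_error_le μ hstat hcyc hmix hψ
    hdistinct hmeas hψhat hsign j hj
  set c := √(μ.real univ) with hc
  have hc0 : 0 ≤ c := Real.sqrt_nonneg _
  let Z : ℕ → Ω → ℝ := fun n ω =>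
    2 * c * ‖ψhat n j ω - ψ j‖ + ‖S.meanHatL2 D μ n ω - S.meanL2 μ‖
  have hZm : ∀ n, AEMeasurable (Z n) P := fun n =>
    ((((hmeas n j).sub aestronglyMeasurable_const).norm.const_mul _).add
      ((S.stronglyMeasurable_meanHatL2 D μ n).sub
        stronglyMeasurable_const).norm.aestronglyMeasurable).aemeasurable
  have hZ0 : ∀ n ω, 0 ≤ Z n ω := fun n ω => by positivity
  have hpos : ∀ᶠ n : ℕ in atTop, 0 < (n : ℝ) ^ (-(1 / 2) : ℝ) := by
    filter_upwards [eventually_gt_atTop 0] with n hn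
    exact Real.rpow_pos_of_pos (by exact_mod_cast hn) _
  have hψ1 : ‖ψ j‖ = 1 := hψ.orthonormal.1 j
  have hψhat1 : ∀ n, p < n → ∀ᵐ ω ∂P, ‖ψhat n j ω‖ = 1 := fun n hn =>
    (hψhat n hn).mono fun ω h => h.orthonormal.1 j
  have hdiff : ∀ f g : Lp ℝ 2 μ, ‖f‖ ≤ c → ‖g‖ ≤ c → ‖f - g‖ ≤ 2 * c := fun f g hf hg =>
    (norm_sub_le _ _).trans (by linarith)
  -- Remainders: `E[Z n | Ξ]` for (i), since the bound is obtained under the conditional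
  -- expectation, and `Z n` for (ii).
  refine ⟨⟨fun n => P[Z n | S.Xi], fun n =>
      (stronglyMeasurable_condExp.mono S.Xi_le).measurable.aemeasurable, ?_, ?_⟩,
    ⟨Z, hZm, ?_, ?_⟩⟩
  · refine isBigOP_of_integral_abs_le hK0 hpos (Eventually.of_forall fun n => integrable_condExp) ?_
    filter_upwards [eventually_gt_atTop p] with n hn
    refine (integral_abs_condExp_le (m := S.Xi) (Z n)).trans ?_
    simp_rw [abs_of_nonneg (hZ0 n _)]
    exact (hK n hn).2
  · intro n hn t ht _
    -- The oracle score, with true mean and true eigenfunction. The direction `ψhat` depends on the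
    -- data and cannot be taken out of the conditional expectation, whereas `V` has conditional
    -- expectation `W`.
    let V : Ω → ℝ := fun ω => ⟪S.FhatL2 D μ t ω, ψ j⟫ - ⟪S.meanL2 μ, ψ j⟫
    have hFm := S.stronglyMeasurable_FhatL2 D μ t
    have hVi₁ : Integrable (fun ω => ⟪S.FhatL2 D μ t ω, ψ j⟫) P :=
      Integrable.of_bound (hFm.inner stronglyMeasurable_const).aestronglyMeasurable (c * 1)
        (ae_of_all _ fun ω => (norm_inner_le_norm _ _).trans (by
          rw [hψ1]; gcongr; exact S.norm_FhatL2_le D μ t ω))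
    have hVi : Integrable V P := hVi₁.sub (integrable_const _)
    have hWi : Integrable (S.What D n (ψhat n j) t) P := by
      refine Integrable.of_bound ((hFm.sub
        (S.stronglyMeasurable_meanHatL2 D μ n)).aestronglyMeasurable.inner (hmeas n j)) (2 * c) ?_
      filter_upwards [hψhat1 n hn] with ω h1
      refine (norm_inner_le_norm _ _).trans ?_
      rw [h1, mul_one]
      exact hdiff _ _ (S.norm_FhatL2_le D μ t ω) (S.norm_meanHatL2_le D μ n ω)
    have hbound : ∀ ω, |S.What D n (ψhat n j) t ω - V ω| ≤ Z n ω := by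
      intro ω
      have he : S.What D n (ψhat n j) t ω - V ω
          = ⟪S.FhatL2 D μ t ω - S.meanHatL2 D μ n ω, ψhat n j ω - ψ j⟫
            - ⟪S.meanHatL2 D μ n ω - S.meanL2 μ, ψ j⟫ := by
        simp only [ConjugateProcess.What, V, inner_sub_left, inner_sub_right]; ring
      rw [he]
      refine (abs_sub _ _).trans (add_le_add ((abs_real_inner_le_norm _ _).trans ?_)
        ((abs_real_inner_le_norm _ _).trans ?_))
      · gcongr
        exact hdiff _ _ (S.norm_FhatL2_le D μ t ω) (S.norm_meanHatL2_le D μ n ω)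
      · rw [hψ1, mul_one]
    have hZi : Integrable (Z n) P := (hK n hn).1
    have hup := condExp_mono (m := S.Xi) (hWi.sub hVi) hZi
      (ae_of_all _ fun ω => (abs_le.1 (hbound ω)).2)
    have hlow := condExp_mono (m := S.Xi) hZi.neg (hWi.sub hVi)
      (ae_of_all _ fun ω => (abs_le.1 (hbound ω)).1)
    filter_upwards [hup, hlow, condExp_neg (Z n) S.Xi, condExp_sub hWi hVi S.Xi,
      condExp_sub hVi₁ (integrable_const ⟪S.meanL2 μ, ψ j⟫) S.Xi,
      S.condExp_inner_FhatL2 D μ ht (ψ j)] with ω h1 h2 h3 h4 h5 h6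
    have h7 : (P[V | S.Xi]) ω = S.W (ψ j) t ω := by
      rw [ConjugateProcess.W, inner_sub_left, ← h6]
      refine h5.trans ?_
      rw [Pi.sub_apply, condExp_const S.Xi_le]
    rw [h4, Pi.sub_apply, h7] at h1 h2
    rw [h3, Pi.neg_apply] at h2
    exact abs_le.2 ⟨h2, h1⟩
  · refine isBigOP_of_integral_abs_le hK0 hpos
      (eventually_gt_atTop p |>.mono fun n hn => (hK n hn).1) ?_
    filter_upwards [eventually_gt_atTop p] with n hn
    simp_rw [abs_of_nonneg (hZ0 n _)]
    exact (hK n hn).2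
  · intro n hn t ht _
    filter_upwards [hψhat1 n hn] with ω h1
    -- Here `Fhat t - F t` is paired with `ψhat`, of norm `1`, so that its norm enters with
    -- coefficient exactly `1`; the change of direction acts only on `F t - E F 0`.
    have he : S.What D n (ψhat n j) t ω - S.W (ψ j) t ω
        = ⟪S.FhatL2 D μ t ω - S.FL2 μ t ω, ψhat n j ω⟫
          + (⟪S.FL2 μ t ω - S.meanL2 μ, ψhat n j ω - ψ j⟫
            - ⟪S.meanHatL2 D μ n ω - S.meanL2 μ, ψhat n j ω⟫) := by
      simp only [ConjugateProcess.What, ConjugateProcess.W, inner_sub_left, inner_sub_right]; ring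
    rw [he]
    refine (abs_add_le _ _).trans (add_le_add ((abs_real_inner_le_norm _ _).trans ?_)
      ((abs_sub _ _).trans (add_le_add ((abs_real_inner_le_norm _ _).trans ?_)
        ((abs_real_inner_le_norm _ _).trans ?_))))
    · rw [h1, mul_one]
    · gcongr
      exact hdiff _ _ (ConjugateProcess.norm_distL2_le μ _) (ConjugateProcess.norm_distL2_le μ _)
    · rw [h1, mul_one]
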